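/- Let $S^{1,1}$ be the circle $U(1)\subset\mathbb{C}$ with the involution $\tau(u)=\bar u$, whose fixed points are $\pm1$, and write $\mathbb{Z}_2=\{1,-1\}$. For a smooth manifold $M$ with a smooth involution $\tau$ and $\epsilon\in\{0,1\}$, let $\mathcal{U}^\epsilon$ be the $\mathbb{Z}_2$-equivariant sheaf of smooth $U(1)$-valued functions on $M$, where $\mathbb{Z}_2$ acts on $U(1)$ trivially if $\epsilon=0$ and by complex conjugation if $\epsilon=1$, and let $H^n(M;\mathbb{Z}_2,\mathcal{U}^\epsilon)$ be Grothendieck's equivariant sheaf cohomology, that is, the $n$-th right derived functor of the functor of invariant global sections, evaluated at $\mathcal{U}^\epsilon$. For $(n,\epsilon)=(1,0)$ and $(n,\epsilon)=(2,1)$ the group $H^n(\mathrm{pt};\mathbb{Z}_2,\mathcal{U}^\epsilon)$ has exactly two elements, hence is uniquely isomorphic to $\mathbb{Z}_2$, and for $\xi\in H^n(M;\mathbb{Z}_2,\mathcal{U}^\epsilon)$ and a fixed point $m\in M^\tau$ with inclusion $\iota_m\colon\{m\}\hookrightarrow M$ the sign choice of $\xi$ at $m$ is $$\sigma_n(\xi)(m)=\iota_m^*(\xi)\in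 H^n(\{m\};\mathbb{Z}_2,\mathcal{U}^\epsilon)=\mathbb{Z}_2 .$$ For $M=S^{1,1}$ the function $\sigma_2(\xi)$ is locally constant on the fixed point set for every $\xi$, and the sign choice map $$\sigma_2\colon H^2(S^{1,1};\mathbb{Z}_2,\mathcal{U}^1)\longrightarrow H^0\big((S^{1,1})^\tau,\mathbb{Z}_2\big)\cong\mathbb{Z}_2^2$$ is an isomorphism of groups, where the last identification is the isomorphism $f\mapsto(f(1),f(-1))$. Likewise, the sign choice map $$\sigma_1\colon H^1(S^{1,1};\mathbb{Z}_2,\mathcal{U}^0)\longrightarrow H^0\big((S^{1,1})^\tau,\mathbb{Z}_2\big)\cong\mathbb{Z}_2^2$$ on the group that classifies $\mathbb{Z}_2$-equivariant line bundles on $S^{1,1}$ is an isomorphism of groups. -/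

import Mathlib

open CategoryTheory Opposite TopologicalSpace
open scoped Manifold ContDiff

noncomputable section

namespace SignChoice

/-! ### Equivariant sheaves

For a discrete group `G` acting on a space `X`, a `G`-equivariant sheaf on `X` is the same thing as
a sheaf on the following site: the objects are the open subsets of `X`, a morphism `U ⟶ V` is an
element `g` of `G` with `g • U ⊆ V`, and a family of morphisms `gᵢ : Uᵢ ⟶ V` covers if the sets
`gᵢ • Uᵢ` cover `V`. (The restriction maps along the morphisms `1 : U ⟶ V` are those of the
underlying sheaf on `X`, and the restriction maps along `g : U ⟶ g • U` are its equivariant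
structure.) -/

/-- The open subsets of `X`, as objects of the site of the `G`-space `X`. -/
structure EqOpens (G X : Type) [TopologicalSpace X] where
  /-- the underlying open set -/
  carrier : Opens X

section Site

variable {G X : Type} [Group G] [TopologicalSpace X] [MulAction G X]

instance : SmallCategory (EqOpens G X) where
  Hom U V := {g : G // ∀ x ∈ U.carrier, g • x ∈ V.carrier}
  id _ := ⟨1, fun x hx => by simpa using hx⟩
  comp f g := ⟨g.1 * f.1, fun x hx => by
    rw [mul_smul]; exact g.2 _ (f.2 _ hx)⟩
  id_comp _ := Subtype.ext (mul_one _)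
  comp_id _ := Subtype.ext (one_mul _)
  assoc _ _ _ := Subtype.ext (mul_assoc _ _ _).symm

/-- The morphism `U ⟶ V` given by a group element `g` with `g • U ⊆ V`. -/
def EqOpens.homMk {U V : EqOpens G X} (g : G) (h : ∀ x ∈ U.carrier, g • x ∈ V.carrier) : U ⟶ V :=
  ⟨g, h⟩

/-- The group element underlying a morphism. -/
def EqOpens.elt {U V : EqOpens G X} (f : U ⟶ V) : G := f.1

theorem EqOpens.elt_mem {U V : EqOpens G X} (f : U ⟶ V) {x : X} (hx : x ∈ U.carrier) :
    EqOpens.elt f • x ∈ V.carrier := f.2 x hx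

@[simp] theorem EqOpens.elt_homMk {U V : EqOpens G X} (g : G)
    (h : ∀ x ∈ U.carrier, g • x ∈ V.carrier) : EqOpens.elt (EqOpens.homMk g h) = g := rfl

@[simp] theorem EqOpens.elt_id (U : EqOpens G X) : EqOpens.elt (𝟙 U) = 1 := rfl

@[simp] theorem EqOpens.elt_comp {U V W : EqOpens G X} (f : U ⟶ V) (g : V ⟶ W) :
    EqOpens.elt (f ≫ g) = EqOpens.elt g * EqOpens.elt f := rfl

theorem EqOpens.hom_ext {U V : EqOpens G X} {f g : U ⟶ V}
    (h : EqOpens.elt f = EqOpens.elt g) : f = g := Subtype.ext h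

variable [ContinuousConstSMul G X]

/-- The translate of `U` by `g⁻¹`, that is, `{x | g • x ∈ U}`. -/
def EqOpens.translate (g : G) (U : EqOpens G X) : EqOpens G X :=
  ⟨⟨{x | g • x ∈ U.carrier}, U.carrier.isOpen.preimage (continuous_const_smul g)⟩⟩

variable (G X) in
/-- The Grothendieck topology of the site of the `G`-space `X`. -/
def eqTopology : GrothendieckTopology (EqOpens G X) where
  sieves V := {S | ∀ x ∈ V.carrier, ∃ (U : EqOpens G X) (f : U ⟶ V), S f ∧
    ∃ y ∈ U.carrier, EqOpens.elt f • y = x}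
  top_mem' V := fun x hx => ⟨V, 𝟙 V, trivial, x, hx, by simp⟩
  pullback_stable' := by
    intro V W S f hS x hx
    obtain ⟨U, g, hg, y, hy, hyx⟩ := hS _ (EqOpens.elt_mem f hx)
    let k : G := (EqOpens.elt f)⁻¹ * EqOpens.elt g
    let U' : EqOpens G X := ⟨U.carrier ⊓ (EqOpens.translate k W).carrier⟩
    have hk : k • y = x := by
      simp only [k, mul_smul, hyx, inv_smul_smul]
    have h₁ : ∀ z ∈ U'.carrier, (1 : G) • z ∈ U.carrier := fun z hz => by
      rw [one_smul]; exact hz.1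
    have h₂ : ∀ z ∈ U'.carrier, k • z ∈ W.carrier := fun z hz => hz.2
    refine ⟨U', EqOpens.homMk k h₂, ?_, y, ⟨hy, show k • y ∈ W.carrier by rw [hk]; exact hx⟩, hk⟩
    have h : EqOpens.homMk k h₂ ≫ f = EqOpens.homMk 1 h₁ ≫ g := by
      apply EqOpens.hom_ext
      rw [EqOpens.elt_comp, EqOpens.elt_comp, EqOpens.elt_homMk, EqOpens.elt_homMk, mul_one]
      exact mul_inv_cancel_left _ _
    change S (EqOpens.homMk k h₂ ≫ f)
    rw [h]
    exact S.downward_closed hg _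
  transitive' := by
    intro V S hS R hR x hx
    obtain ⟨U, f, hf, y, hy, hyx⟩ := hS x hx
    obtain ⟨W, g, hg, z, hz, hzy⟩ := hR hf y hy
    exact ⟨W, g ≫ f, hg, z, hz, by simp [mul_smul, hzy, hyx]⟩

/-- The category of `G`-equivariant sheaves of abelian groups on `X`. -/
abbrev EqSheaf (G X : Type) [Group G] [TopologicalSpace X] [MulAction G X]
    [ContinuousConstSMul G X] := Sheaf (eqTopology G X) AddCommGrpCat.{0}

/-- Grothendieck's equivariant sheaf cohomology `Hⁿ(X; G, F)`: the `n`-th derived functor of the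
invariant global sections `F ↦ Hom(ℤ, F) = Γ(X, F)^G`. -/
abbrev EqCohomology {G X : Type} [Group G] [TopologicalSpace X] [MulAction G X]
    [ContinuousConstSMul G X] (F : EqSheaf G X) (n : ℕ) : Type := Sheaf.H.{0} F n

end Site

/-! ### Pullback in equivariant cohomology -/

section Pullback

variable {G X Y : Type} [Group G] [TopologicalSpace X] [MulAction G X]
  [TopologicalSpace Y] [MulAction G Y]

/-- Inverse image of open sets along a continuous equivariant map, as a functor between sites. -/
def comap (φ : Y →[G] X) (hφ : Continuous φ) : EqOpens G X ⥤ EqOpens G Y where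
  obj U := ⟨⟨φ ⁻¹' U.carrier, U.carrier.isOpen.preimage hφ⟩⟩
  map {U V} f := EqOpens.homMk (EqOpens.elt f) (fun y hy => by
    change φ (EqOpens.elt f • y) ∈ V.carrier
    rw [map_smul]
    exact EqOpens.elt_mem f hy)
  map_id _ := rfl
  map_comp _ _ := rfl

variable [ContinuousConstSMul G X] [ContinuousConstSMul G Y]
variable (φ : Y →[G] X) (hφ : Continuous φ)

instance : RepresentablyFlat (comap φ hφ) where
  cofiltered W :=
    { nonempty := ⟨StructuredArrow.mk (Y := (⟨⊤⟩ : EqOpens G X))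
        (EqOpens.homMk 1 (fun _ _ => trivial))⟩
      cone_objs := by
        intro A B
        let a : G := EqOpens.elt A.hom
        let b : G := EqOpens.elt B.hom
        let U : EqOpens G X :=
          ⟨(EqOpens.translate a A.right).carrier ⊓ (EqOpens.translate b B.right).carrier⟩
        let C : StructuredArrow W (comap φ hφ) :=
          StructuredArrow.mk (Y := U) (EqOpens.homMk 1 (fun y hy => by
            refine ⟨?_, ?_⟩
            · change a • φ ((1 : G) • y) ∈ A.right.carrier
              rw [one_smul, ← map_smul]
              exact EqOpens.elt_mem A.hom hy
            · change b • φ ((1 : G) • y) ∈ B.right.carrier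
              rw [one_smul, ← map_smul]
              exact EqOpens.elt_mem B.hom hy))
        refine ⟨C, StructuredArrow.homMk (EqOpens.homMk a (fun x hx => hx.1)) ?_,
          StructuredArrow.homMk (EqOpens.homMk b (fun x hx => hx.2)) ?_, trivial⟩
        · exact EqOpens.hom_ext (mul_one a)
        · exact EqOpens.hom_ext (mul_one b)
      cone_maps := by
        intro A B f g
        refine ⟨A, 𝟙 A, ?_⟩
        congr 1
        apply StructuredArrow.hom_ext
        apply EqOpens.hom_ext
        have hf : EqOpens.elt f.right * EqOpens.elt A.hom = EqOpens.elt B.hom :=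
          congrArg EqOpens.elt (StructuredArrow.w f)
        have hg : EqOpens.elt g.right * EqOpens.elt A.hom = EqOpens.elt B.hom :=
          congrArg EqOpens.elt (StructuredArrow.w g)
        exact mul_right_cancel (hf.trans hg.symm) }

instance : (comap φ hφ).Final := final_of_representablyFlat _

instance : (comap φ hφ).IsContinuous (eqTopology G X) (eqTopology G Y) :=
  Functor.isContinuous_of_coverPreserving (compatiblePreservingOfFlat _ _)
    { cover_preserve := by
        intro V S hS y hy
        obtain ⟨U, f, hf, x, hx, hxy⟩ := hS (φ y) hy
        have h : φ ((EqOpens.elt f)⁻¹ • y) = x := by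
          rw [map_smul, ← hxy, inv_smul_smul]
        refine ⟨(comap φ hφ).obj U, (comap φ hφ).map f, Sieve.image_mem_functorPushforward _ _ hf,
          (EqOpens.elt f)⁻¹ • y, ?_, ?_⟩
        · change φ _ ∈ U.carrier
          rw [h]; exact hx
        · exact smul_inv_smul _ _ }

/-- Direct image `φ_*` of equivariant sheaves: `(φ_* F)(U) = F(φ⁻¹ U)`. -/
abbrev directImage : EqSheaf G Y ⥤ EqSheaf G X :=
  (comap φ hφ).sheafPushforwardContinuous AddCommGrpCat.{0} (eqTopology G X) (eqTopology G Y)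

/-- Inverse image `φ⁻¹` of equivariant sheaves, the exact left adjoint of `φ_*`. -/
abbrev inverseImage : EqSheaf G X ⥤ EqSheaf G Y :=
  (comap φ hφ).sheafPullback AddCommGrpCat.{0} (eqTopology G X) (eqTopology G Y)

/-- The adjunction between inverse and direct image. -/
abbrev imageAdj : inverseImage φ hφ ⊣ directImage φ hφ :=
  (comap φ hφ).sheafAdjunctionContinuous AddCommGrpCat.{0} (eqTopology G X) (eqTopology G Y)

instance : (directImage φ hφ).Additive where
  map_add := rfl

instance : (inverseImage φ hφ).Additive := (imageAdj φ hφ).left_adjoint_additive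

instance : Limits.PreservesFiniteColimits (inverseImage φ hφ) :=
  have := (imageAdj φ hφ).leftAdjoint_preservesColimits
  inferInstance

instance : Limits.PreservesFiniteLimits (inverseImage φ hφ) := by
  have : Limits.PreservesFiniteLimits
    ((comap φ hφ).op.lan : (_ ⥤ _ ⥤ AddCommGrpCat.{0})) := lan_preservesFiniteLimits_of_flat _ _
  exact Functor.sheafPullbackConstruction.preservesFiniteLimits _ _ _ _

variable (G X) in
/-- The constant equivariant sheaf `ℤ`. -/
abbrev constZ : EqSheaf G X :=
  (constantSheaf (eqTopology G X) AddCommGrpCat.{0}).obj (AddCommGrpCat.of (ULift ℤ))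

/-- The canonical map `ℤ ⟶ φ⁻¹ ℤ`: it corresponds to the invariant section of `φ⁻¹ ℤ` obtained
from the section `1` of `ℤ` through the unit `ℤ ⟶ φ_* φ⁻¹ ℤ` of the adjunction. -/
def constToInverseImage : constZ G Y ⟶ (inverseImage φ hφ).obj (constZ G X) :=
  ((sheafificationAdjunction (eqTopology G Y) AddCommGrpCat.{0}).homEquiv _ _).symm
    (((Functor.Initial.extendCone (F := (comap φ hφ).op)).obj
      ⟨AddCommGrpCat.of (ULift ℤ),
        ((sheafificationAdjunction (eqTopology G X) AddCommGrpCat.{0}).homEquiv _ _)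
          ((imageAdj φ hφ).unit.app (constZ G X))⟩).π)

/-- The pullback `φ^* : Hⁿ(X; G, F) → Hⁿ(Y; G, F')` along `φ`, for equivariant sheaves `F` on `X`
and `F'` on `Y` and a morphism `a : F ⟶ φ_* F'`: the exact functor `φ⁻¹` gives a class in
`Extⁿ(φ⁻¹ ℤ, φ⁻¹ F)`, which is then composed with `ℤ ⟶ φ⁻¹ ℤ` and with the morphism
`φ⁻¹ F ⟶ F'` adjoint to `a`. -/
def pullback {F : EqSheaf G X} {F' : EqSheaf G Y} (a : F ⟶ (directImage φ hφ).obj F') (n : ℕ) :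
    EqCohomology F n →+ EqCohomology F' n :=
  (((Abelian.Ext.mk₀ (((imageAdj φ hφ).homEquiv _ _).symm a)).postcomp _ (add_zero n)).comp
    ((Abelian.Ext.mk₀ (constToInverseImage φ hφ)).precomp _ (zero_add n))).comp
    ((inverseImage φ hφ).mapExtAddHom (constZ G X) F n)

end Pullback

/-! ### Orientifolds and the sheaves `𝒰^ε`

The group `ℤ₂` is written multiplicatively, as `ℤˣ = {1, -1}`. An action of `ℤˣ` on `M` is the same
thing as an involution `τ` of `M`, namely `τ x = (-1) • x`. -/

/-- The action of the group `G` on the manifold `M` is by smooth maps. -/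
class SmoothConstSMul (G : Type) [Group G] {E H : Type} [NormedAddCommGroup E] [NormedSpace ℝ E]
    [TopologicalSpace H] (I : ModelWithCorners ℝ E H) (M : Type) [TopologicalSpace M]
    [ChartedSpace H M] [MulAction G M] : Prop where
  contMDiff_smul : ∀ g : G, ContMDiff I I ∞ (fun x : M => g • x)

section Orientifold

/-- The action of `g : ℤˣ` on `U(1)` in `𝒰^ε`: it is trivial if `ε = 0`, and for `ε = 1` the
element `-1` acts by complex conjugation `z ↦ z̄ = z⁻¹`. -/
def circleAct (ε : ZMod 2) (g : ℤˣ) : Circle →* Circle := zpowGroupHom ((g ^ ε : ℤˣ) : ℤ)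

theorem circleAct_one (ε : ZMod 2) (z : Circle) : circleAct ε 1 z = z := by
  simp [circleAct]

theorem circleAct_mul (ε : ZMod 2) (g h : ℤˣ) (z : Circle) :
    circleAct ε (g * h) z = circleAct ε g (circleAct ε h z) := by
  simp only [circleAct, zpowGroupHom_apply, mul_uzpow, Units.val_mul, ← zpow_mul]
  rw [mul_comm]

theorem contMDiff_circleAct (ε : ZMod 2) (g : ℤˣ) :
    ContMDiff (𝓡 1) (𝓡 1) ∞ (circleAct ε g) := by
  rcases Int.units_eq_one_or (g ^ ε) with h | h
  · have : (circleAct ε g : Circle → Circle) = id := by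
      funext z; simp [circleAct, h]
    rw [this]
    exact contMDiff_id
  · have : (circleAct ε g : Circle → Circle) = fun z => z⁻¹ := by
      funext z; simp [circleAct, h]
    rw [this]
    exact contMDiff_inv (𝓡 1) ∞

variable {E H : Type} [NormedAddCommGroup E] [NormedSpace ℝ E] [TopologicalSpace H]
  (I : ModelWithCorners ℝ E H) (M : Type) [TopologicalSpace M] [ChartedSpace H M]
  [MulAction ℤˣ M]

/-- Sections of `𝒰^ε` over `U`: the group of smooth functions `U → U(1)`. -/
abbrev USections (U : EqOpens ℤˣ M) : Type := C^∞⟮I, U.carrier; 𝓡 1, Circle⟯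

variable {I M} in
/-- The restriction map of `𝒰^ε` along `g : U ⟶ V` sends `f : V → U(1)` to
`x ↦ g⁻¹ · f (g x)`. -/
def uRestrict [SmoothConstSMul ℤˣ I M] (ε : ZMod 2) {U V : EqOpens ℤˣ M} (g : U ⟶ V) :
    USections I M V →* USections I M U where
  toFun f := ⟨fun x => circleAct ε (EqOpens.elt g)⁻¹
      (f ⟨EqOpens.elt g • x.1, EqOpens.elt_mem g x.2⟩), by
    refine (contMDiff_circleAct ε _).comp (f.contMDiff.comp ?_)
    rw [← ContMDiff.subtypeVal_comp_iff]
    exact (SmoothConstSMul.contMDiff_smul (EqOpens.elt g)).comp contMDiff_subtype_val⟩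
  map_one' := by ext1 x; exact map_one (circleAct ε (EqOpens.elt g)⁻¹)
  map_mul' f₁ f₂ := by ext1 x; exact map_mul (circleAct ε (EqOpens.elt g)⁻¹) _ _

variable {I M} in
theorem uRestrict_apply [SmoothConstSMul ℤˣ I M] (ε : ZMod 2) {U V : EqOpens ℤˣ M} (g : U ⟶ V)
    (f : USections I M V) (x : U.carrier) :
    uRestrict ε g f x = circleAct ε (EqOpens.elt g)⁻¹
      (f ⟨EqOpens.elt g • x.1, EqOpens.elt_mem g x.2⟩) := rfl

variable [SmoothConstSMul ℤˣ I M]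

/-- The equivariant presheaf underlying `𝒰^ε`. -/
def uPresheaf (ε : ZMod 2) : (EqOpens ℤˣ M)ᵒᵖ ⥤ AddCommGrpCat.{0} where
  obj U := AddCommGrpCat.of (Additive (USections I M U.unop))
  map g := AddCommGrpCat.ofHom (MonoidHom.toAdditive (uRestrict ε g.unop))
  map_id U := by
    have : uRestrict (I := I) ε (𝟙 U.unop) = MonoidHom.id _ := by
      ext1 f
      ext1 x
      change circleAct ε (1 : ℤˣ)⁻¹ (f ⟨(1 : ℤˣ) • x.1, _⟩) = f x
      rw [inv_one, circleAct_one]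
      congr 1
      exact Subtype.ext (one_smul _ _)
    rw [unop_id, this]
    rfl
  map_comp {U V W} g h := by
    have : uRestrict (I := I) ε (h.unop ≫ g.unop)
        = (uRestrict (I := I) ε h.unop).comp (uRestrict (I := I) ε g.unop) := by
      ext1 f
      ext1 x
      change circleAct ε (EqOpens.elt g.unop * EqOpens.elt h.unop)⁻¹
        (f ⟨(EqOpens.elt g.unop * EqOpens.elt h.unop) • x.1, _⟩) =
        circleAct ε (EqOpens.elt h.unop)⁻¹ (circleAct ε (EqOpens.elt g.unop)⁻¹
          (f ⟨EqOpens.elt g.unop • EqOpens.elt h.unop • x.1, _⟩))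
      rw [mul_inv_rev, circleAct_mul]
      congr 4
      exact mul_smul _ _ _
    rw [unop_comp, this]
    rfl

variable [ContinuousConstSMul ℤˣ M]

theorem uPresheaf_isSheaf (ε : ZMod 2) :
    Presheaf.IsSheaf (eqTopology ℤˣ M) (uPresheaf I M ε) := by
  rw [Presheaf.isSheaf_iff_isSheaf_forget _ _ (forget AddCommGrpCat.{0}),
    isSheaf_iff_isSheaf_of_type]
  intro U S hS x hx
  let s {V : EqOpens ℤˣ M} (f : V ⟶ U) (hf : S f) : USections I M V := x f hf
  have hs {V V' Z : EqOpens ℤˣ M} (f : V ⟶ U) (hf : S f) (f' : V' ⟶ U) (hf' : S f')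
      (a : Z ⟶ V) (b : Z ⟶ V') (h : a ≫ f = b ≫ f') :
      uRestrict ε a (s f hf) = uRestrict ε b (s f' hf') := hx a b hf hf' h
  choose W φ hφ y hy hyp using hS
  classical
  let t : M → Circle := fun p => if h : p ∈ U.carrier then
    circleAct ε (EqOpens.elt (φ p h)) (s (φ p h) (hφ p h) ⟨y p h, hy p h⟩) else 1
  have key {V : EqOpens ℤˣ M} (f : V ⟶ U) (hf : S f) (z : M) (hz : z ∈ V.carrier) :
      t (EqOpens.elt f • z) = circleAct ε (EqOpens.elt f) (s f hf ⟨z, hz⟩) := by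
    have hp : EqOpens.elt f • z ∈ U.carrier := EqOpens.elt_mem f hz
    obtain ⟨p, hpdef⟩ : ∃ p, p = EqOpens.elt f • z := ⟨_, rfl⟩
    rw [← hpdef] at hp ⊢
    simp only [t, dif_pos hp]
    let k : ℤˣ := (EqOpens.elt (φ p hp))⁻¹ * EqOpens.elt f
    have hk : k • z = y p hp := by
      rw [mul_smul, ← hpdef, inv_smul_eq_iff, hyp]
    let Z : EqOpens ℤˣ M := ⟨V.carrier ⊓ (EqOpens.translate k (W p hp)).carrier⟩
    have h₁ : ∀ q ∈ Z.carrier, (1 : ℤˣ) • q ∈ V.carrier := fun q hq => by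
      rw [one_smul]; exact hq.1
    have h₂ : ∀ q ∈ Z.carrier, k • q ∈ (W p hp).carrier := fun q hq => hq.2
    have hc : EqOpens.homMk 1 h₁ ≫ f = EqOpens.homMk k h₂ ≫ φ p hp := by
      apply EqOpens.hom_ext
      rw [EqOpens.elt_comp, EqOpens.elt_comp, EqOpens.elt_homMk, EqOpens.elt_homMk, mul_one]
      exact (mul_inv_cancel_left _ _).symm
    have hzZ : z ∈ Z.carrier := ⟨hz, show k • z ∈ (W p hp).carrier by rw [hk]; exact hy p hp⟩
    have e := DFunLike.congr_fun (hs f hf (φ p hp) (hφ p hp) _ _ hc) ⟨z, hzZ⟩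
    rw [uRestrict_apply, uRestrict_apply] at e
    simp only [EqOpens.elt_homMk, inv_one, circleAct_one, one_smul, hk] at e
    rw [e, ← circleAct_mul]
    congr 2
    simp only [k, mul_inv_rev, inv_inv, mul_inv_cancel_left]
  have smooth : ContMDiff I (𝓡 1) ∞ (fun p : U.carrier => t p.1) := by
    intro p
    rw [contMDiffAt_subtype_iff]
    let f := φ p.1 p.2
    let V := W p.1 p.2
    let N : Opens M := (EqOpens.translate (EqOpens.elt f)⁻¹ V).carrier
    have hpN : p.1 ∈ N := by
      change (EqOpens.elt f)⁻¹ • p.1 ∈ V.carrier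
      have h : (EqOpens.elt f)⁻¹ • p.1 = y p.1 p.2 := by
        rw [inv_smul_eq_iff, hyp]
      rw [h]
      exact hy p.1 p.2
    have : ContMDiffAt I (𝓡 1) ∞ (fun q : N => t q.1) ⟨p.1, hpN⟩ := by
      have e : (fun q : N => t q.1) = fun q : N => circleAct ε (EqOpens.elt f)
          (s f (hφ p.1 p.2) ⟨(EqOpens.elt f)⁻¹ • q.1, q.2⟩) := by
        funext q
        have h := key f (hφ p.1 p.2) ((EqOpens.elt f)⁻¹ • q.1) q.2
        rw [smul_inv_smul] at h
        exact h
      rw [e]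
      refine ContMDiff.contMDiffAt ?_
      refine (contMDiff_circleAct ε _).comp ((s f (hφ p.1 p.2)).contMDiff.comp ?_)
      rw [← ContMDiff.subtypeVal_comp_iff]
      exact (SmoothConstSMul.contMDiff_smul (EqOpens.elt f)⁻¹).comp contMDiff_subtype_val
    exact contMDiffAt_subtype_iff (x := (⟨p.1, hpN⟩ : N)).1 this
  let T : USections I M U := ⟨fun p => t p.1, smooth⟩
  refine ⟨T, ?_, ?_⟩
  · intro V f hf
    change uRestrict ε f T = s f hf
    ext1 z
    rw [uRestrict_apply]
    change circleAct ε _ (t _) = _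
    rw [key f hf z.1 z.2, ← circleAct_mul, inv_mul_cancel, circleAct_one]
  · intro T' hT'
    have hT'' {V : EqOpens ℤˣ M} (f : V ⟶ U) (hf : S f) : uRestrict ε f T' = s f hf := hT' f hf
    apply ContMDiffMap.ext
    intro p
    change _ = t p.1
    have e := DFunLike.congr_fun (hT'' (φ p.1 p.2) (hφ p.1 p.2)) ⟨y p.1 p.2, hy p.1 p.2⟩
    have ht : t p.1 = circleAct ε (EqOpens.elt (φ p.1 p.2))
        (s (φ p.1 p.2) (hφ p.1 p.2) ⟨y p.1 p.2, hy p.1 p.2⟩) := dif_pos p.2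
    rw [ht, ← e]
    refine Eq.trans ?_ (congrArg (circleAct ε (EqOpens.elt (φ p.1 p.2)))
      (uRestrict_apply (I := I) ε (φ p.1 p.2) T' ⟨y p.1 p.2, hy p.1 p.2⟩)).symm
    rw [← circleAct_mul, mul_inv_cancel, circleAct_one]
    exact congrArg T'.1 (Subtype.ext (hyp p.1 p.2).symm)

/-- The `ℤ₂`-equivariant sheaf `𝒰^ε` on `M` of smooth `U(1)`-valued functions; invariant global
sections are the smooth `f : M → U(1)` with `f ∘ τ = f` if `ε = 0`, and with `f ∘ τ = f̄` (the Real
functions) if `ε = 1`. -/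
def uSheaf (ε : ZMod 2) : EqSheaf ℤˣ M := ⟨uPresheaf I M ε, uPresheaf_isSheaf I M ε⟩

section Functoriality

variable {E' H' : Type} [NormedAddCommGroup E'] [NormedSpace ℝ E'] [TopologicalSpace H']
  (I' : ModelWithCorners ℝ E' H') {M} {N : Type} [TopologicalSpace N] [ChartedSpace H' N]
  [MulAction ℤˣ N] [SmoothConstSMul ℤˣ I' N] [ContinuousConstSMul ℤˣ N]

/-- Composition with a smooth equivariant map `φ : N → M`, as a morphism `𝒰^ε ⟶ φ_* 𝒰^ε`. -/
def uComp (ε : ZMod 2) (φ : N →[ℤˣ] M) (hφ : ContMDiff I' I ∞ φ) :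
    uSheaf I M ε ⟶ (directImage φ hφ.continuous).obj (uSheaf I' N ε) :=
  ObjectProperty.homMk
    { app := fun U => AddCommGrpCat.ofHom (MonoidHom.toAdditive
        { toFun := fun (f : USections I M U.unop) =>
            (⟨fun x => f ⟨φ x.1, x.2⟩, f.contMDiff.comp (by
              rw [← ContMDiff.subtypeVal_comp_iff]
              exact hφ.comp contMDiff_subtype_val)⟩ :
              USections I' N ((comap φ hφ.continuous).obj U.unop))
          map_one' := rfl
          map_mul' := fun _ _ => rfl })
      naturality := fun U V g => by
        ext f
        change USections I M U.unop at f
        apply ContMDiffMap.ext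
        intro x
        change circleAct ε _ (f ⟨_ • φ x.1, _⟩) = circleAct ε _ (f ⟨φ (_ • x.1), _⟩)
        congr 3
        exact (map_smul φ _ _).symm }

/-- The pullback `φ^* : Hⁿ(M; ℤ₂, 𝒰^ε) → Hⁿ(N; ℤ₂, 𝒰^ε)` along a smooth equivariant map. -/
def uPullback (ε : ZMod 2) (φ : N →[ℤˣ] M) (hφ : ContMDiff I' I ∞ φ) (n : ℕ) :
    EqCohomology (uSheaf I M ε) n →+ EqCohomology (uSheaf I' N ε) n :=
  pullback φ hφ.continuous (uComp I I' ε φ hφ) n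

end Functoriality

end Orientifold

/-! ### Sign choices -/

/-- The involution on the one-point manifold is trivial. -/
instance : SmoothConstSMul ℤˣ 𝓘(ℝ, PUnit) PUnit where
  contMDiff_smul _ := contMDiff_const

instance : ContinuousConstSMul ℤˣ PUnit where
  continuous_const_smul _ := continuous_const

/-- The cohomology `Hⁿ(pt; ℤ₂, 𝒰^ε)` of a point. -/
abbrev PointCohomology (n : ℕ) (ε : ZMod 2) : Type := EqCohomology (uSheaf 𝓘(ℝ, PUnit) PUnit ε) n

open Classical in
/-- The identification of `Hⁿ(pt; ℤ₂, 𝒰^ε)`, whenever it is a group of order two, with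
`ℤ₂ = {1, -1}`: the trivial class has sign `1` and the non-trivial one has sign `-1`. -/
def pointSign {n : ℕ} {ε : ZMod 2} (ξ : PointCohomology n ε) : ℤˣ := if ξ = 0 then 1 else -1

section Sign

variable {E H : Type} [NormedAddCommGroup E] [NormedSpace ℝ E] [TopologicalSpace H]
  (I : ModelWithCorners ℝ E H) {M : Type} [TopologicalSpace M] [ChartedSpace H M]
  [MulAction ℤˣ M]

/-- The inclusion `ι_m` of a fixed point `m`, as an equivariant map. -/
def pointInclusion (m : MulAction.fixedPoints ℤˣ M) : PUnit →[ℤˣ] M where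
  toFun _ := m.1
  map_smul' g _ := (m.2 g).symm

theorem contMDiff_pointInclusion (m : MulAction.fixedPoints ℤˣ M) :
    ContMDiff 𝓘(ℝ, PUnit) I ∞ (pointInclusion m) := contMDiff_const

variable [SmoothConstSMul ℤˣ I M] [ContinuousConstSMul ℤˣ M]

/-- The sign choice of a class `ξ ∈ Hⁿ(M; ℤ₂, 𝒰^ε)` at a fixed point `m`: the sign of
`ι_m^* ξ ∈ Hⁿ({m}; ℤ₂, 𝒰^ε)`. -/
def signChoice {n : ℕ} {ε : ZMod 2} (ξ : EqCohomology (uSheaf I M ε) n)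
    (m : MulAction.fixedPoints ℤˣ M) : ℤˣ :=
  pointSign (uPullback I 𝓘(ℝ, PUnit) ε (pointInclusion m) (contMDiff_pointInclusion I m) n ξ)

end Sign

/-! ### The circle `S^{1,1}` -/

/-- The orientifold `S^{1,1}`: the circle `U(1)` with the involution `u ↦ ū = u⁻¹`. -/
instance : MulAction ℤˣ Circle where
  smul g u := u ^ (g : ℤ)
  one_smul u := by change u ^ ((1 : ℤˣ) : ℤ) = u; simp
  mul_smul g h u := by
    change u ^ ((g * h : ℤˣ) : ℤ) = (u ^ (h : ℤ)) ^ (g : ℤ)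
    rw [Units.val_mul, ← zpow_mul, mul_comm]

theorem smul_circle_def (g : ℤˣ) (u : Circle) : g • u = u ^ (g : ℤ) := rfl

theorem coe_neg_one_smul_circle (u : Circle) :
    (((-1 : ℤˣ) • u : Circle) : ℂ) = starRingEnd ℂ u := by
  rw [smul_circle_def, Units.val_neg, Units.val_one, zpow_neg_one, Circle.coe_inv_eq_conj]

instance : SmoothConstSMul ℤˣ (𝓡 1) Circle where
  contMDiff_smul g := by
    have h := contMDiff_circleAct 1 g
    simp only [circleAct, uzpow_one] at h
    exact h

instance : ContinuousConstSMul ℤˣ Circle where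
  continuous_const_smul g := (SmoothConstSMul.contMDiff_smul (I := 𝓡 1) g).continuous

/-- The cohomology `Hⁿ(S^{1,1}; ℤ₂, 𝒰^ε)`. -/
abbrev CircleCohomology (n : ℕ) (ε : ZMod 2) : Type := EqCohomology (uSheaf (𝓡 1) Circle ε) n

/-- The fixed point `1` of `S^{1,1}`. -/
def fixedOne : MulAction.fixedPoints ℤˣ Circle := ⟨1, fun g => one_zpow (g : ℤ)⟩

/-- The fixed point `-1` of `S^{1,1}`. -/
def fixedNegOne : MulAction.fixedPoints ℤˣ Circle := ⟨-1, fun g => by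
  rw [smul_circle_def]
  rcases Int.units_eq_one_or g with rfl | rfl <;> simp⟩

/-- The group `H⁰(M^τ, ℤ₂)` of sign choices: locally constant functions `M^τ → {1, -1}`. -/
abbrev SignChoices (M : Type) [TopologicalSpace M] [MulAction ℤˣ M] : Type :=
  LocallyConstant (MulAction.fixedPoints ℤˣ M) ℤˣ

end SignChoice

end

/-!
The cohomology of `𝒰^ε` is computed from the periodic resolution of the constant sheaf `ℤ` by the
sheaf `P` of the regular representation `ℤ[ℤ₂]`, spliced from the extensions
`0 ⟶ ℤ_sign ⟶ P ⟶ ℤ ⟶ 0` and `0 ⟶ ℤ ⟶ P ⟶ ℤ_sign ⟶ 0` (`augSeq_shortExact`,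
`signSeq_shortExact`). Morphisms `P ⟶ F` are global sections of `F`, so `Extⁿ(P, F)` is the
non-equivariant cohomology of `F`. If it vanishes for `n = 1, 2`, the long exact sequences identify
`H¹(M; ℤ₂, F)` with anti-invariant sections modulo those of the form `s - τ s`, and `H²(M; ℤ₂, F)`
with invariant sections modulo those of the form `s + τ s`. Both for `F = 𝒰⁰` in degree one and for
`F = 𝒰¹` in degree two the outcome is the same group: smooth functions `f : M → U(1)` with
`f ∘ τ = f⁻¹`, modulo the functions `g / (g ∘ τ)` (`presents_signClassRel`,
`presents_trivClassRel`). The extensions are compatible with inverse images, so the pullback of the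
class of `f` is the class of the pullback of `f` (`pullback_signClass`, `pullback_trivClass`).

On a point every epimorphism of sheaves is surjective on global sections, so `Extⁿ(P, F)` vanishes
for `n = 1, 2`; the group is `{1, -1}`, and the sign choice of the class of `f` at a fixed point
`m` is `f(m)`.

On the circle, the vanishing of `Ext¹(P, F)` holds whenever germs at pairs of points extend to global
sections (`secMap_top_surjective`): a section of a quotient is lifted over the sublevel sets of the
real part, whose level sets consist of at most two points. The sheaf `𝒰^ε` has this extension
property by means of local angles and bump functions, and so has every quotient of an injective
sheaf, because injective sheaves are flasque. The latter yields `Ext²(P, F) = 0` for every `F` by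
dimension shifting.

It remains to see that evaluation at `1` and `-1` induces a bijection from the functions `f` with
`f(ū) = f(u)⁻¹`, modulo the functions `g(u) / g(ū)`, onto the pairs of signs. Surjectivity is
witnessed by `1`, `u`, `-u`, `-1`. If `f(1) = f(-1) = 1`, then `f` has even degree, so that a smooth
square root `g` of `f` exists, normalised by `g(1) = 1`, and `f(u) = g(u) / g(ū)` (`exists_div_eq`).
-/

noncomputable section

namespace SignChoice

/-! ### Sheaves attached to abelian groups with involution -/

section RepSheaf

variable (X : Type) [TopologicalSpace X] [MulAction ℤˣ X]
variable {A B : Type} [AddCommGroup A] [AddCommGroup B]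
  (ρ : ℤˣ →* AddMonoid.End A) (ρ' : ℤˣ →* AddMonoid.End B)

/-- The presheaf with all sections equal to `A`, in which a morphism of the site acts through the
group element underlying it. (As `ℤˣ` is commutative, the action `ρ` may be used contravariantly.) -/
def repPresheaf : (EqOpens ℤˣ X)ᵒᵖ ⥤ AddCommGrpCat.{0} where
  obj _ := AddCommGrpCat.of A
  map g := AddCommGrpCat.ofHom (ρ (EqOpens.elt g.unop))
  map_id U := by
    rw [unop_id, EqOpens.elt_id, map_one]
    rfl
  map_comp g h := by
    rw [unop_comp, EqOpens.elt_comp, mul_comm, map_mul]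
    rfl

variable {ρ ρ'}

/-- An equivariant homomorphism, as a morphism of presheaves. -/
def repPresheafMap (j : A →+ B) (hj : ∀ g a, j (ρ g a) = ρ' g (j a)) :
    repPresheaf X ρ ⟶ repPresheaf X ρ' where
  app _ := AddCommGrpCat.ofHom j
  naturality _ _ g := by
    ext a
    exact hj _ a

variable [ContinuousConstSMul ℤˣ X]

variable (ρ) in
/-- The equivariant sheaf attached to `A`: the constant sheaf `A` with equivariant structure given
by the action of `ℤˣ` on `A`. -/
abbrev repSheaf : EqSheaf ℤˣ X :=
  (presheafToSheaf (eqTopology ℤˣ X) AddCommGrpCat.{0}).obj (repPresheaf X ρ)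

/-- An equivariant homomorphism, as a morphism of equivariant sheaves. -/
abbrev repSheafMap (j : A →+ B) (hj : ∀ g a, j (ρ g a) = ρ' g (j a)) :
    repSheaf X ρ ⟶ repSheaf X ρ' :=
  (presheafToSheaf (eqTopology ℤˣ X) AddCommGrpCat.{0}).map (repPresheafMap X j hj)

end RepSheaf

section EvTop

variable {X : Type} [TopologicalSpace X] [MulAction ℤˣ X]

/-- The group of sections of a presheaf over the whole space. -/
abbrev topSections (F : (EqOpens ℤˣ X)ᵒᵖ ⥤ AddCommGrpCat.{0}) : Type := F.obj (op ⟨⊤⟩)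

/-- The morphism from an open set to the whole space given by `g`. -/
def toTop (g : ℤˣ) (U : EqOpens ℤˣ X) : U ⟶ ⟨⊤⟩ := EqOpens.homMk g (fun _ _ => trivial)

theorem comp_toTop {U V : EqOpens ℤˣ X} (g : ℤˣ) (f : U ⟶ V) :
    f ≫ toTop g V = toTop (g * EqOpens.elt f) U := EqOpens.hom_ext rfl

/-- The action of `g` on global sections. -/
def topAct (F : (EqOpens ℤˣ X)ᵒᵖ ⥤ AddCommGrpCat.{0}) (g : ℤˣ) :
    topSections F →+ topSections F :=
  (F.map (toTop g ⟨⊤⟩).op).hom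

theorem topAct_one (F : (EqOpens ℤˣ X)ᵒᵖ ⥤ AddCommGrpCat.{0}) (s : topSections F) :
    topAct F 1 s = s :=
  congrArg (fun k => k.hom s) (F.map_id (op (⟨⊤⟩ : EqOpens ℤˣ X)))

theorem topAct_mul (F : (EqOpens ℤˣ X)ᵒᵖ ⥤ AddCommGrpCat.{0}) (g h : ℤˣ) (s : topSections F) :
    topAct F g (topAct F h s) = topAct F (g * h) s := by
  have e : toTop g ⟨⊤⟩ ≫ toTop h ⟨⊤⟩ = toTop (X := X) (g * h) ⟨⊤⟩ := by
    rw [comp_toTop, mul_comm]; rfl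
  have e' := congrArg (fun k => F.map k.op s) e
  simp only [op_comp, F.map_comp, ConcreteCategory.comp_apply] at e'
  exact e'

variable {A B : Type} [AddCommGroup A] [AddCommGroup B]
  {ρ : ℤˣ →* AddMonoid.End A} {ρ' : ℤˣ →* AddMonoid.End B}

/-- A morphism from the presheaf of `A` is determined by an equivariant homomorphism from `A` to
the global sections. -/
def repPresheafLift {F : (EqOpens ℤˣ X)ᵒᵖ ⥤ AddCommGrpCat.{0}} (e : A →+ topSections F)
    (he : ∀ g a, topAct F g (e a) = e (ρ g a)) : repPresheaf X ρ ⟶ F where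
  app U := AddCommGrpCat.ofHom ((F.map (toTop 1 U.unop).op).hom.comp e)
  naturality U V g := by
    ext a
    change F.map (toTop 1 V.unop).op (e (ρ (EqOpens.elt g.unop) a)) =
      F.map g (F.map (toTop 1 U.unop).op (e a))
    have h : toTop 1 V.unop ≫ toTop (EqOpens.elt g.unop) ⟨⊤⟩ = g.unop ≫ toTop 1 U.unop := by
      rw [comp_toTop, comp_toTop, mul_comm]
      rfl
    have h' := congrArg (fun k => F.map k.op (e a)) h
    simp only [op_comp, F.map_comp, ConcreteCategory.comp_apply] at h'
    exact (congrArg _ (he _ a).symm).trans h'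

theorem repPresheaf_hom_ext {F : (EqOpens ℤˣ X)ᵒᵖ ⥤ AddCommGrpCat.{0}}
    {f f' : repPresheaf X ρ ⟶ F} (h : ∀ a : A, f.app (op ⟨⊤⟩) a = f'.app (op ⟨⊤⟩) a) :
    f = f' := by
  ext U a
  let r := toTop 1 U.unop
  have hr : (repPresheaf X ρ).map r.op a = a := by
    change ρ 1 a = a
    rw [map_one]; rfl
  have e1 := congrArg (fun k => k.hom a) (f.naturality r.op)
  have e2 := congrArg (fun k => k.hom a) (f'.naturality r.op)
  change f.app U ((repPresheaf X ρ).map r.op a) = F.map r.op (f.app _ a) at e1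
  change f'.app U ((repPresheaf X ρ).map r.op a) = F.map r.op (f'.app _ a) at e2
  rw [hr] at e1 e2
  exact e1.trans ((congrArg _ (h a)).trans e2.symm)

variable [ContinuousConstSMul ℤˣ X]

/-- The homomorphism from `A` to the global sections of `F` given by a morphism from the sheaf of
`A` to `F`. -/
def evTop {F : EqSheaf ℤˣ X} (f : repSheaf X ρ ⟶ F) : A →+ topSections F.obj :=
  (((sheafificationAdjunction (eqTopology ℤˣ X) AddCommGrpCat.{0}).homEquiv _ _ f).app
    (op ⟨⊤⟩)).hom

theorem topAct_evTop {F : EqSheaf ℤˣ X} (f : repSheaf X ρ ⟶ F) (g : ℤˣ) (a : A) :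
    topAct F.obj g (evTop f a) = evTop f (ρ g a) :=
  (congrArg (fun k => k.hom a) (((sheafificationAdjunction (eqTopology ℤˣ X)
    AddCommGrpCat.{0}).homEquiv _ _ f).naturality (toTop g ⟨⊤⟩).op)).symm

theorem evTop_injective {F : EqSheaf ℤˣ X} {f f' : repSheaf X ρ ⟶ F}
    (h : ∀ a, evTop f a = evTop f' a) : f = f' :=
  ((sheafificationAdjunction (eqTopology ℤˣ X) AddCommGrpCat.{0}).homEquiv _ _).injective
    (repPresheaf_hom_ext h)

theorem exists_evTop_eq {F : EqSheaf ℤˣ X} (e : A →+ topSections F.obj)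
    (he : ∀ g a, topAct F.obj g (e a) = e (ρ g a)) :
    ∃ f : repSheaf X ρ ⟶ F, ∀ a, evTop f a = e a := by
  refine ⟨((sheafificationAdjunction (eqTopology ℤˣ X) AddCommGrpCat.{0}).homEquiv _ _).symm
    (repPresheafLift e he), fun a => ?_⟩
  rw [evTop, Equiv.apply_symm_apply]
  exact topAct_one F.obj (e a)

theorem evTop_comp {F F' : EqSheaf ℤˣ X} (f : repSheaf X ρ ⟶ F) (k : F ⟶ F') (a : A) :
    evTop (f ≫ k) a = k.hom.app (op ⟨⊤⟩) (evTop f a) := by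
  rw [evTop, Adjunction.homEquiv_naturality_right]
  rfl

theorem evTop_repSheafMap_comp {F : EqSheaf ℤˣ X} (j : A →+ B)
    (hj : ∀ g a, j (ρ g a) = ρ' g (j a)) (f : repSheaf X ρ' ⟶ F) (a : A) :
    evTop (repSheafMap X j hj ≫ f) a = evTop f (j a) := by
  rw [evTop, Adjunction.homEquiv_naturality_left]
  rfl

theorem evTop_add {F : EqSheaf ℤˣ X} (f f' : repSheaf X ρ ⟶ F) (a : A) :
    evTop (f + f') a = evTop f a + evTop f' a := by
  rw [evTop, Adjunction.homEquiv_apply]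
  rfl

end EvTop

/-! ### The periodic resolution of the constant sheaf -/

/-- The action of `ℤˣ` on `ℤ` by signs. -/
def signRep : ℤˣ →* AddMonoid.End ℤ := DistribMulAction.toAddMonoidEnd ℤˣ ℤ

/-- The regular representation of `ℤˣ`, on functions `ℤˣ → ℤ`. -/
def regRep : ℤˣ →* AddMonoid.End (ℤˣ → ℤ) where
  toFun g :=
    { toFun := fun f x => f (x * g)
      map_zero' := rfl
      map_add' := fun _ _ => rfl }
  map_one' := by ext1 f; funext x; exact congrArg f (mul_one x)
  map_mul' g h := by ext1 f; funext x; exact congrArg f (mul_assoc x g h).symm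

/-- The trivial action on the group `ℤ` whose constant sheaf defines cohomology: `repSheaf X trivRep`
is definitionally `constZ ℤˣ X`, so `Ext (repSheaf X trivRep) F n` is `EqCohomology F n`. -/
abbrev trivRep : ℤˣ →* AddMonoid.End (ULift.{0} ℤ) := 1

theorem signRep_apply (g : ℤˣ) (n : ℤ) : signRep g n = g * n := rfl

theorem regRep_apply (g : ℤˣ) (f : ℤˣ → ℤ) (x : ℤˣ) : regRep g f x = f (x * g) := rfl

/-- The antidiagonal inclusion of the sign representation into the regular one. -/
def signToReg : ℤ →+ (ℤˣ → ℤ) where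
  toFun n x := x * n
  map_zero' := by funext x; simp
  map_add' a b := by funext x; simp [mul_add]

/-- The augmentation of the regular representation. -/
def regToTriv : (ℤˣ → ℤ) →+ ULift.{0} ℤ where
  toFun f := ⟨f 1 + f (-1)⟩
  map_zero' := rfl
  map_add' a b := by ext; simp; ring

/-- The diagonal inclusion of the trivial representation into the regular one. -/
def trivToReg : ULift.{0} ℤ →+ (ℤˣ → ℤ) where
  toFun n _ := n.down
  map_zero' := rfl
  map_add' _ _ := rfl

/-- The augmentation of the regular representation twisted by signs. -/
def regToSign : (ℤˣ → ℤ) →+ ℤ where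
  toFun f := f 1 - f (-1)
  map_zero' := rfl
  map_add' a b := by simp; ring

theorem signToReg_equivariant (g : ℤˣ) (n : ℤ) :
    signToReg (signRep g n) = regRep g (signToReg n) := by
  funext x
  simp [signToReg, signRep_apply, regRep_apply, mul_assoc]

theorem regToTriv_equivariant (g : ℤˣ) (f : ℤˣ → ℤ) :
    regToTriv (regRep g f) = trivRep g (regToTriv f) := by
  rcases Int.units_eq_one_or g with rfl | rfl
  · simp
  · ext
    simp [regToTriv, regRep_apply, add_comm]

theorem trivToReg_equivariant (g : ℤˣ) (n : ULift.{0} ℤ) :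
    trivToReg (trivRep g n) = regRep g (trivToReg n) := rfl

theorem regToSign_equivariant (g : ℤˣ) (f : ℤˣ → ℤ) :
    regToSign (regRep g f) = signRep g (regToSign f) := by
  rcases Int.units_eq_one_or g with rfl | rfl <;>
    simp [regToSign, regRep_apply, signRep_apply]

theorem regToTriv_signToReg (n : ℤ) : regToTriv (signToReg n) = 0 := by
  ext
  simp [regToTriv, signToReg]

section Sequences

variable (X : Type) [TopologicalSpace X] [MulAction ℤˣ X]

theorem repPresheaf_shortExact {A B C : Type} [AddCommGroup A] [AddCommGroup B] [AddCommGroup C]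
    {α : ℤˣ →* AddMonoid.End A} {β : ℤˣ →* AddMonoid.End B} {γ : ℤˣ →* AddMonoid.End C}
    (i : A →+ B) (hi : ∀ g a, i (α g a) = β g (i a))
    (p : B →+ C) (hp : ∀ g b, p (β g b) = γ g (p b))
    (hinj : Function.Injective i) (hsurj : Function.Surjective p)
    (h : Function.Exact i p) (w : repPresheafMap X i hi ≫ repPresheafMap X p hp = 0) :
    (ShortComplex.mk (repPresheafMap X i hi) (repPresheafMap X p hp) w).ShortExact := by
  have hJ : JointlyReflectIsomorphisms
      (fun U => (evaluation (EqOpens ℤˣ X)ᵒᵖ AddCommGrpCat.{0}).obj U) :=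
    ⟨fun f _ => by
      have (U : (EqOpens ℤˣ X)ᵒᵖ) : IsIso (f.app U) :=
        inferInstanceAs (IsIso (((evaluation (EqOpens ℤˣ X)ᵒᵖ AddCommGrpCat.{0}).obj U).map f))
      exact NatIso.isIso_of_isIso_app f⟩
  rw [hJ.shortExact_iff]
  intro U
  refine @ShortComplex.ShortExact.mk _ _ _ _ ?_ ?_ ?_
  · rw [ShortComplex.ab_exact_iff]
    exact fun b hb => (h b).1 hb
  · exact (AddCommGrpCat.mono_iff_injective _).2 hinj
  · exact (AddCommGrpCat.epi_iff_surjective _).2 hsurj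

variable [ContinuousConstSMul ℤˣ X]

/-- The short exact sequence of equivariant sheaves `0 ⟶ ℤ_sign ⟶ ℤ[ℤ₂] ⟶ ℤ ⟶ 0`. -/
def augSeq : ShortComplex (EqSheaf ℤˣ X) :=
  (ShortComplex.mk (repPresheafMap X signToReg signToReg_equivariant)
    (repPresheafMap X regToTriv regToTriv_equivariant) (by
      ext U n
      exact regToTriv_signToReg n)).map (presheafToSheaf (eqTopology ℤˣ X) AddCommGrpCat.{0})

/-- The short exact sequence of equivariant sheaves `0 ⟶ ℤ ⟶ ℤ[ℤ₂] ⟶ ℤ_sign ⟶ 0`. -/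
def signSeq : ShortComplex (EqSheaf ℤˣ X) :=
  (ShortComplex.mk (repPresheafMap X trivToReg trivToReg_equivariant)
    (repPresheafMap X regToSign regToSign_equivariant) (by
      ext U n
      change regToSign (trivToReg n) = 0
      simp [regToSign, trivToReg])).map (presheafToSheaf (eqTopology ℤˣ X) AddCommGrpCat.{0})

theorem augSeq_shortExact : (augSeq X).ShortExact := by
  refine ShortComplex.ShortExact.map_of_exact (repPresheaf_shortExact X _ _ _ _ ?_ ?_ ?_ _) _
  · intro a b h
    simpa [signToReg] using congrFun h 1
  · intro n
    refine ⟨Pi.single 1 n.down, ?_⟩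
    ext
    simp [regToTriv]
  · intro f
    constructor
    · intro h
      have h' : f 1 + f (-1) = 0 := congrArg ULift.down h
      refine ⟨f 1, ?_⟩
      funext x
      rcases Int.units_eq_one_or x with rfl | rfl
      · simp [signToReg]
      · simp [signToReg]; linarith
    · rintro ⟨n, rfl⟩
      ext
      simp [regToTriv, signToReg]

theorem signSeq_shortExact : (signSeq X).ShortExact := by
  refine ShortComplex.ShortExact.map_of_exact (repPresheaf_shortExact X _ _ _ _ ?_ ?_ ?_ _) _
  · intro a b h
    exact ULift.ext _ _ (congrFun h 1)
  · intro n
    exact ⟨Pi.single 1 n, by simp [regToSign]⟩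
  · intro f
    constructor
    · intro h
      have h' : f 1 - f (-1) = 0 := h
      refine ⟨⟨f 1⟩, ?_⟩
      funext x
      rcases Int.units_eq_one_or x with rfl | rfl
      · simp [trivToReg]
      · simp [trivToReg]; linarith
    · rintro ⟨n, rfl⟩
      simp [regToSign, trivToReg]

end Sequences

section ExtClasses

open Abelian

variable (X : Type) [TopologicalSpace X] [MulAction ℤˣ X] [ContinuousConstSMul ℤˣ X]

/-- The inclusion `ℤ_sign ⟶ ℤ[ℤ₂]` of sheaves. -/
abbrev signToRegSheaf : repSheaf X signRep ⟶ repSheaf X regRep :=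
  repSheafMap X signToReg signToReg_equivariant

/-- The inclusion `ℤ ⟶ ℤ[ℤ₂]` of sheaves. -/
abbrev trivToRegSheaf : repSheaf X trivRep ⟶ repSheaf X regRep :=
  repSheafMap X trivToReg trivToReg_equivariant

/-- The class of the extension `0 ⟶ ℤ_sign ⟶ ℤ[ℤ₂] ⟶ ℤ ⟶ 0`. -/
def augExt : Ext (repSheaf X trivRep) (repSheaf X signRep) 1 := (augSeq_shortExact X).extClass

/-- The class of the extension `0 ⟶ ℤ ⟶ ℤ[ℤ₂] ⟶ ℤ_sign ⟶ 0`. -/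
def signExt : Ext (repSheaf X signRep) (repSheaf X trivRep) 1 := (signSeq_shortExact X).extClass

variable {X} {F : EqSheaf ℤˣ X} {m n : ℕ}

theorem augExt_exact₁ (x : Ext (repSheaf X signRep) F n) (hn : 1 + n = m)
    (hx : (augExt X).comp x hn = 0) :
    ∃ y : Ext (repSheaf X regRep) F n, (Ext.mk₀ (signToRegSheaf X)).comp y (zero_add n) = x :=
  Ext.contravariant_sequence_exact₁ (augSeq_shortExact X) F x hn hx

theorem augExt_comp_surjective (hn : 1 + n = m) (h : ∀ x : Ext (repSheaf X regRep) F m, x = 0)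
    (x : Ext (repSheaf X trivRep) F m) :
    ∃ y : Ext (repSheaf X signRep) F n, (augExt X).comp y hn = x :=
  Ext.contravariant_sequence_exact₃ (augSeq_shortExact X) F x (h _) hn

theorem augExt_comp_eq_zero (hn : 1 + n = m) (y : Ext (repSheaf X regRep) F n) :
    (augExt X).comp ((Ext.mk₀ (signToRegSheaf X)).comp y (zero_add n)) hn = 0 :=
  (augSeq_shortExact X).extClass_comp_assoc y

theorem signExt_exact₁ (x : Ext (repSheaf X trivRep) F n) (hn : 1 + n = m)
    (hx : (signExt X).comp x hn = 0) :
    ∃ y : Ext (repSheaf X regRep) F n, (Ext.mk₀ (trivToRegSheaf X)).comp y (zero_add n) = x :=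
  Ext.contravariant_sequence_exact₁ (signSeq_shortExact X) F x hn hx

theorem signExt_comp_surjective (hn : 1 + n = m) (h : ∀ x : Ext (repSheaf X regRep) F m, x = 0)
    (x : Ext (repSheaf X signRep) F m) :
    ∃ y : Ext (repSheaf X trivRep) F n, (signExt X).comp y hn = x :=
  Ext.contravariant_sequence_exact₃ (signSeq_shortExact X) F x (h _) hn

theorem signExt_comp_eq_zero (hn : 1 + n = m) (y : Ext (repSheaf X regRep) F n) :
    (signExt X).comp ((Ext.mk₀ (trivToRegSheaf X)).comp y (zero_add n)) hn = 0 :=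
  (signSeq_shortExact X).extClass_comp_assoc y

end ExtClasses

section Hom

variable {X : Type} [TopologicalSpace X] [MulAction ℤˣ X] [ContinuousConstSMul ℤˣ X]
  (F : EqSheaf ℤˣ X)

/-- The generator of the regular representation. -/
def regGen : ℤˣ → ℤ := Pi.single 1 1

theorem eq_regGen (f : ℤˣ → ℤ) : f = f 1 • regGen + f (-1) • regRep (-1) regGen := by
  funext x
  rcases Int.units_eq_one_or x with rfl | rfl <;> simp [regGen, regRep_apply]

variable {F}

theorem exists_evTop_regGen (s : topSections F.obj) :
    ∃ f : repSheaf X regRep ⟶ F, evTop f regGen = s := by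
  obtain ⟨f, hf⟩ := exists_evTop_eq (X := X) (ρ := regRep) (F := F)
    (AddMonoidHom.mk' (fun a => a 1 • s + a (-1) • topAct F.obj (-1) s) (fun a b => by
      simp only [Pi.add_apply, add_smul]; abel)) (fun g a => by
      rcases Int.units_eq_one_or g with rfl | rfl
      · rw [topAct_one, map_one]; rfl
      · simp only [AddMonoidHom.mk'_apply, map_add, map_zsmul, topAct_mul, regRep_apply]
        norm_num [topAct_one, add_comm])
  refine ⟨f, (hf _).trans ?_⟩
  simp [regGen]

theorem reg_hom_ext {f f' : repSheaf X regRep ⟶ F} (h : evTop f regGen = evTop f' regGen) :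
    f = f' := by
  refine evTop_injective fun a => ?_
  rw [eq_regGen a]
  simp only [map_add, map_zsmul, ← topAct_evTop, h]

theorem exists_evTop_sign (s : topSections F.obj) (hs : topAct F.obj (-1) s = -s) :
    ∃ f : repSheaf X signRep ⟶ F, evTop f 1 = s := by
  obtain ⟨f, hf⟩ := exists_evTop_eq (X := X) (ρ := signRep) (F := F)
    (zmultiplesHom _ s) (fun g a => by
      rcases Int.units_eq_one_or g with rfl | rfl
      · rw [topAct_one, map_one]; rfl
      · simp [hs, signRep_apply])
  refine ⟨f, (hf _).trans ?_⟩
  simp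

theorem exists_evTop_triv (s : topSections F.obj) (hs : topAct F.obj (-1) s = s) :
    ∃ f : repSheaf X trivRep ⟶ F, evTop f ⟨1⟩ = s := by
  obtain ⟨f, hf⟩ := exists_evTop_eq (X := X) (ρ := trivRep) (F := F)
    ((zmultiplesHom _ s).comp AddEquiv.ulift.toAddMonoidHom) (fun g a => by
      rcases Int.units_eq_one_or g with rfl | rfl
      · rw [topAct_one, map_one]; rfl
      · simp [hs])
  exact ⟨f, (hf _).trans (one_zsmul s)⟩

theorem sign_hom_ext {f f' : repSheaf X signRep ⟶ F} (h : evTop f 1 = evTop f' 1) : f = f' := by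
  refine evTop_injective fun a => ?_
  have : a = a • (1 : ℤ) := by simp
  rw [this, map_zsmul, map_zsmul, h]

theorem triv_hom_ext {f f' : repSheaf X trivRep ⟶ F} (h : evTop f ⟨1⟩ = evTop f' ⟨1⟩) :
    f = f' := by
  refine evTop_injective fun a => ?_
  have : a = a.down • (⟨1⟩ : ULift.{0} ℤ) := by ext; simp
  rw [this, map_zsmul, map_zsmul, h]

end Hom

/-! ### Classes of invariant and anti-invariant sections -/

section Classes

open Abelian

variable {X : Type} [TopologicalSpace X] [MulAction ℤˣ X] [ContinuousConstSMul ℤˣ X]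
  {F : EqSheaf ℤˣ X}

/-- The class in `H¹(X; ℤ₂, F)` of a morphism `ℤ_sign ⟶ F`. -/
def signClass (f : repSheaf X signRep ⟶ F) : Ext (repSheaf X trivRep) F 1 :=
  (augExt X).comp (Ext.mk₀ f) (add_zero 1)

/-- The class in `H²(X; ℤ₂, F)` of a morphism `ℤ ⟶ F`, obtained by splicing the two sequences. -/
def trivClass (f : repSheaf X trivRep ⟶ F) : Ext (repSheaf X trivRep) F 2 :=
  (augExt X).comp ((signExt X).comp (Ext.mk₀ f) (add_zero 1)) one_add_one_eq_two

theorem signClass_add (f f' : repSheaf X signRep ⟶ F) :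
    signClass (f + f') = signClass f + signClass f' := by
  simp only [signClass, Ext.mk₀_add, Ext.comp_add]

theorem trivClass_add (f f' : repSheaf X trivRep ⟶ F) :
    trivClass (f + f') = trivClass f + trivClass f' := by
  simp only [trivClass, Ext.mk₀_add, Ext.comp_add]

theorem signClass_surjective (h : ∀ x : Ext (repSheaf X regRep) F 1, x = 0) :
    Function.Surjective (signClass (F := F)) := by
  intro x
  obtain ⟨y, hy⟩ := augExt_comp_surjective (add_zero 1) h x
  obtain ⟨f, rfl⟩ := (Ext.mk₀_bijective _ _).2 y
  exact ⟨f, hy⟩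

theorem trivClass_surjective (h₁ : ∀ x : Ext (repSheaf X regRep) F 1, x = 0)
    (h₂ : ∀ x : Ext (repSheaf X regRep) F 2, x = 0) :
    Function.Surjective (trivClass (F := F)) := by
  intro x
  obtain ⟨y, hy⟩ := augExt_comp_surjective one_add_one_eq_two h₂ x
  obtain ⟨z, hz⟩ := signExt_comp_surjective (add_zero 1) h₁ y
  obtain ⟨f, rfl⟩ := (Ext.mk₀_bijective _ _).2 z
  exact ⟨f, by rw [trivClass, hz, hy]⟩

theorem signToReg_one : signToReg 1 = regGen - regRep (-1) regGen := by
  funext x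
  rcases Int.units_eq_one_or x with rfl | rfl <;> simp [signToReg, regGen, regRep_apply]

theorem trivToReg_one : trivToReg ⟨1⟩ = regGen + regRep (-1) regGen := by
  funext x
  rcases Int.units_eq_one_or x with rfl | rfl <;> simp [trivToReg, regGen, regRep_apply]

theorem signClass_eq_zero_iff (f : repSheaf X signRep ⟶ F) :
    signClass f = 0 ↔ ∃ s : topSections F.obj, evTop f 1 = s - topAct F.obj (-1) s := by
  constructor
  · intro h
    obtain ⟨y, hy⟩ := augExt_exact₁ _ (add_zero 1) h
    obtain ⟨k, rfl⟩ := (Ext.mk₀_bijective _ _).2 y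
    rw [Ext.mk₀_comp_mk₀] at hy
    refine ⟨evTop k regGen, ?_⟩
    rw [← (Ext.mk₀_bijective _ _).1 hy, evTop_repSheafMap_comp, signToReg_one, map_sub,
      topAct_evTop]
  · rintro ⟨s, hs⟩
    obtain ⟨k, rfl⟩ := exists_evTop_regGen s
    have e : signToRegSheaf X ≫ k = f := sign_hom_ext (by
      rw [evTop_repSheafMap_comp, hs, signToReg_one, map_sub, topAct_evTop])
    rw [signClass, ← e, ← Ext.mk₀_comp_mk₀, augExt_comp_eq_zero]

theorem trivClass_eq_zero_iff (h : ∀ x : Ext (repSheaf X regRep) F 1, x = 0)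
    (f : repSheaf X trivRep ⟶ F) :
    trivClass f = 0 ↔ ∃ s : topSections F.obj, evTop f ⟨1⟩ = s + topAct F.obj (-1) s := by
  constructor
  · intro h'
    obtain ⟨y, hy⟩ := augExt_exact₁ _ one_add_one_eq_two h'
    rw [h y, Ext.comp_zero] at hy
    obtain ⟨z, hz⟩ := signExt_exact₁ _ (add_zero 1) hy.symm
    obtain ⟨k, rfl⟩ := (Ext.mk₀_bijective _ _).2 z
    rw [Ext.mk₀_comp_mk₀] at hz
    refine ⟨evTop k regGen, ?_⟩
    rw [← (Ext.mk₀_bijective _ _).1 hz, evTop_repSheafMap_comp, trivToReg_one, map_add,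
      topAct_evTop]
  · rintro ⟨s, hs⟩
    obtain ⟨k, rfl⟩ := exists_evTop_regGen s
    have e : trivToRegSheaf X ≫ k = f := triv_hom_ext (by
      rw [evTop_repSheafMap_comp, hs, trivToReg_one, map_add, topAct_evTop])
    rw [trivClass, ← e, ← Ext.mk₀_comp_mk₀, signExt_comp_eq_zero, Ext.comp_zero]

end Classes

/-! ### Pullback of classes -/

section PullbackClasses

open Abelian

variable {X Y : Type} [TopologicalSpace X] [MulAction ℤˣ X] [ContinuousConstSMul ℤˣ X]
  [TopologicalSpace Y] [MulAction ℤˣ Y] [ContinuousConstSMul ℤˣ Y]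
  (φ : Y →[ℤˣ] X) (hφ : Continuous φ)

theorem exists_repToInverseImage {A : Type} [AddCommGroup A] (ρ : ℤˣ →* AddMonoid.End A) :
    ∃ c : repSheaf Y ρ ⟶ (inverseImage φ hφ).obj (repSheaf X ρ),
      ∀ a, evTop c a =
        ((imageAdj φ hφ).unit.app (repSheaf X ρ)).hom.app (op ⟨⊤⟩) (evTop (𝟙 _) a) := by
  let η := (imageAdj φ hφ).unit.app (repSheaf X ρ)
  refine exists_evTop_eq (F := (inverseImage φ hφ).obj (repSheaf X ρ))
    ((η.hom.app (op ⟨⊤⟩)).hom.comp (evTop (𝟙 (repSheaf X ρ)))) fun g a => ?_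
  change topAct ((inverseImage φ hφ).obj (repSheaf X ρ)).obj g
    (η.hom.app (op ⟨⊤⟩) (evTop (𝟙 _) a)) = η.hom.app (op ⟨⊤⟩) (evTop (𝟙 _) (ρ g a))
  rw [← topAct_evTop]
  exact (congrArg (fun k => k.hom (evTop (𝟙 _) a)) (η.hom.naturality (toTop g ⟨⊤⟩).op)).symm

/-- The canonical morphism from the sheaf of `A` on `Y` to the inverse image of the sheaf of `A`
on `X`. -/
def repToInverseImage {A : Type} [AddCommGroup A] (ρ : ℤˣ →* AddMonoid.End A) :
    repSheaf Y ρ ⟶ (inverseImage φ hφ).obj (repSheaf X ρ) :=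
  (exists_repToInverseImage φ hφ ρ).choose

theorem evTop_repToInverseImage {A : Type} [AddCommGroup A] (ρ : ℤˣ →* AddMonoid.End A) (a : A) :
    evTop (repToInverseImage φ hφ ρ) a =
      ((imageAdj φ hφ).unit.app (repSheaf X ρ)).hom.app (op ⟨⊤⟩) (evTop (𝟙 _) a) :=
  (exists_repToInverseImage φ hφ ρ).choose_spec a

/-- On sections, the composite of the canonical morphism with the inverse image of `f` and the
adjoint of `a` is `a ∘ f`. -/
theorem evTop_repToInverseImage_comp {A : Type} [AddCommGroup A] {ρ : ℤˣ →* AddMonoid.End A}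
    {F : EqSheaf ℤˣ X} {F' : EqSheaf ℤˣ Y} (f : repSheaf X ρ ⟶ F)
    (k : (inverseImage φ hφ).obj F ⟶ F') (x : A) :
    evTop (repToInverseImage φ hφ ρ ≫ (inverseImage φ hφ).map f ≫ k) x =
      ((imageAdj φ hφ).homEquiv _ _ k).hom.app (op ⟨⊤⟩) (evTop f x) := by
  have h := (imageAdj φ hφ).homEquiv_naturality_left f k
  rw [Adjunction.homEquiv_unit] at h
  have h' := congrArg (fun q => q.hom.app (op ⟨⊤⟩) (evTop (𝟙 (repSheaf X ρ)) x)) h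
  rw [evTop_comp, evTop_repToInverseImage]
  refine h'.trans ?_
  change ((imageAdj φ hφ).homEquiv _ _ k).hom.app (op ⟨⊤⟩)
    (f.hom.app (op ⟨⊤⟩) (evTop (𝟙 (repSheaf X ρ)) x)) = _
  rw [← evTop_comp, Category.id_comp]

theorem evTop_repToInverseImage_map {A : Type} [AddCommGroup A] {ρ : ℤˣ →* AddMonoid.End A}
    {F : EqSheaf ℤˣ X} (f : repSheaf X ρ ⟶ F) (x : A) :
    evTop (repToInverseImage φ hφ ρ ≫ (inverseImage φ hφ).map f) x =
      ((imageAdj φ hφ).unit.app F).hom.app (op ⟨⊤⟩) (evTop f x) := by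
  have h := evTop_repToInverseImage_comp φ hφ f (𝟙 _) x
  rw [Category.comp_id, Adjunction.homEquiv_id] at h
  exact h

theorem repToInverseImage_naturality {A B : Type} [AddCommGroup A] [AddCommGroup B]
    {ρ : ℤˣ →* AddMonoid.End A} {ρ' : ℤˣ →* AddMonoid.End B} (j : A →+ B)
    (hj : ∀ g a, j (ρ g a) = ρ' g (j a)) :
    repToInverseImage φ hφ ρ ≫ (inverseImage φ hφ).map (repSheafMap X j hj) =
      repSheafMap Y j hj ≫ repToInverseImage φ hφ ρ' := by
  refine evTop_injective fun x => ?_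
  rw [evTop_repSheafMap_comp, evTop_repToInverseImage, evTop_repToInverseImage_map]
  congr 1
  rw [← evTop_repSheafMap_comp j hj, Category.comp_id]

/-- The morphism through which `pullback` is defined is the canonical one for `trivRep`: both are
determined by their effect on global sections. -/
theorem constToInverseImage_eq :
    constToInverseImage φ hφ = repToInverseImage φ hφ trivRep := by
  refine evTop_injective (X := Y) (ρ := trivRep) fun x => ?_
  refine Eq.trans ?_ (evTop_repToInverseImage φ hφ trivRep x).symm
  let c : Limits.Cone ((comap φ hφ).op ⋙ ((inverseImage φ hφ).obj (constZ ℤˣ X)).obj) :=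
    ⟨AddCommGrpCat.of (ULift ℤ),
        ((sheafificationAdjunction (eqTopology ℤˣ X) AddCommGrpCat.{0}).homEquiv _ _)
          ((imageAdj φ hφ).unit.app (constZ ℤˣ X))⟩
  have h₁ : evTop (X := Y) (ρ := trivRep) (constToInverseImage φ hφ) x =
      (((Functor.Initial.extendCone (F := (comap φ hφ).op)).obj c).π.app (op ⟨⊤⟩)) x := by
    exact congrArg (fun k : repPresheaf Y trivRep ⟶ ((inverseImage φ hφ).obj (constZ ℤˣ X)).obj =>
      (k.app (op ⟨⊤⟩)).hom x) (Equiv.apply_symm_apply _ _)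
  have h₂ : (Functor.Initial.extendCone.obj c).π.app (op ⟨⊤⟩) = c.π.app (op ⟨⊤⟩) :=
    (Functor.Initial.extendCone_obj_π_app' (F := (comap φ hφ).op) c
      (X := op ⟨⊤⟩) (Y := op ⟨⊤⟩) (𝟙 _)).trans
      ((congrArg _ (CategoryTheory.Functor.map_id _ _)).trans (Category.comp_id _))
  have h₃ := evTop_comp (𝟙 (repSheaf X trivRep)) ((imageAdj φ hφ).unit.app (repSheaf X trivRep)) x
  rw [Category.id_comp] at h₃
  refine h₁.trans (Eq.trans ?_ h₃)
  rw [h₂]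
  rfl

/-- The canonical morphism between the sequences `0 ⟶ ℤ_sign ⟶ ℤ[ℤ₂] ⟶ ℤ ⟶ 0`. -/
def augSeqMap : augSeq Y ⟶ (augSeq X).map (inverseImage φ hφ) where
  τ₁ := repToInverseImage φ hφ signRep
  τ₂ := repToInverseImage φ hφ regRep
  τ₃ := repToInverseImage φ hφ trivRep
  comm₁₂ := repToInverseImage_naturality φ hφ signToReg signToReg_equivariant
  comm₂₃ := repToInverseImage_naturality φ hφ regToTriv regToTriv_equivariant

/-- The canonical morphism between the sequences `0 ⟶ ℤ ⟶ ℤ[ℤ₂] ⟶ ℤ_sign ⟶ 0`. -/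
def signSeqMap : signSeq Y ⟶ (signSeq X).map (inverseImage φ hφ) where
  τ₁ := repToInverseImage φ hφ trivRep
  τ₂ := repToInverseImage φ hφ regRep
  τ₃ := repToInverseImage φ hφ signRep
  comm₁₂ := repToInverseImage_naturality φ hφ trivToReg trivToReg_equivariant
  comm₂₃ := repToInverseImage_naturality φ hφ regToSign regToSign_equivariant

theorem augExt_naturality :
    (Ext.mk₀ (repToInverseImage φ hφ trivRep)).comp
      ((augExt X).mapExactFunctor (inverseImage φ hφ)) (zero_add 1) =
    (augExt Y).comp (Ext.mk₀ (repToInverseImage φ hφ signRep)) (add_zero 1) :=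
  (congrArg (fun e => (Ext.mk₀ (repToInverseImage φ hφ trivRep)).comp e (zero_add 1))
    (Ext.mapExactFunctor_extClass _ (augSeq_shortExact X))).trans
    (ShortComplex.ShortExact.extClass_naturality (augSeq_shortExact Y)
      ((augSeq_shortExact X).map_of_exact (inverseImage φ hφ)) (augSeqMap φ hφ)).symm

theorem signExt_naturality :
    (Ext.mk₀ (repToInverseImage φ hφ signRep)).comp
      ((signExt X).mapExactFunctor (inverseImage φ hφ)) (zero_add 1) =
    (signExt Y).comp (Ext.mk₀ (repToInverseImage φ hφ trivRep)) (add_zero 1) :=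
  (congrArg (fun e => (Ext.mk₀ (repToInverseImage φ hφ signRep)).comp e (zero_add 1))
    (Ext.mapExactFunctor_extClass _ (signSeq_shortExact X))).trans
    (ShortComplex.ShortExact.extClass_naturality (signSeq_shortExact Y)
      ((signSeq_shortExact X).map_of_exact (inverseImage φ hφ)) (signSeqMap φ hφ)).symm

variable {F : EqSheaf ℤˣ X} {F' : EqSheaf ℤˣ Y}

theorem pullback_eq (a : F ⟶ (directImage φ hφ).obj F') {n : ℕ} (x : Ext (repSheaf X trivRep) F n) :
    pullback φ hφ a n x =
      ((Ext.mk₀ (repToInverseImage φ hφ trivRep)).comp (x.mapExactFunctor (inverseImage φ hφ))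
        (zero_add n)).comp (Ext.mk₀ (((imageAdj φ hφ).homEquiv _ _).symm a)) (add_zero n) := by
  rw [← constToInverseImage_eq]
  rfl

variable {φ hφ}

/-- The pullback of the class of an anti-invariant section is the class of its pullback. -/
theorem pullback_signClass (a : F ⟶ (directImage φ hφ).obj F')
    (f : repSheaf X signRep ⟶ F) (f' : repSheaf Y signRep ⟶ F')
    (h : evTop f' 1 = a.hom.app (op ⟨⊤⟩) (evTop f 1)) :
    pullback φ hφ a 1 (signClass f) = signClass f' := by
  have e : f' = repToInverseImage φ hφ signRep ≫
      (inverseImage φ hφ).map f ≫ ((imageAdj φ hφ).homEquiv _ _).symm a := sign_hom_ext (by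
    rw [evTop_repToInverseImage_comp, Equiv.apply_symm_apply, h])
  rw [pullback_eq, signClass, Ext.mapExactFunctor_comp, Ext.mapExactFunctor_mk₀, signClass, e,
    Ext.comp_assoc_of_third_deg_zero, Ext.comp_assoc_of_third_deg_zero, Ext.mk₀_comp_mk₀,
    ← Ext.comp_assoc_of_third_deg_zero, augExt_naturality, Ext.comp_assoc_of_third_deg_zero,
    Ext.mk₀_comp_mk₀]

/-- The pullback of the class of an invariant section is the class of its pullback. -/
theorem pullback_trivClass (a : F ⟶ (directImage φ hφ).obj F')
    (f : repSheaf X trivRep ⟶ F) (f' : repSheaf Y trivRep ⟶ F')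
    (h : evTop f' ⟨1⟩ = a.hom.app (op ⟨⊤⟩) (evTop f ⟨1⟩)) :
    pullback φ hφ a 2 (trivClass f) = trivClass f' := by
  have e : f' = repToInverseImage φ hφ trivRep ≫
      (inverseImage φ hφ).map f ≫ ((imageAdj φ hφ).homEquiv _ _).symm a := triv_hom_ext (by
    rw [evTop_repToInverseImage_comp, Equiv.apply_symm_apply, h])
  rw [pullback_eq, trivClass, Ext.mapExactFunctor_comp, Ext.mapExactFunctor_comp,
    Ext.mapExactFunctor_mk₀, trivClass, e, Ext.comp_assoc_of_third_deg_zero,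
    Ext.comp_assoc_of_third_deg_zero, Ext.comp_assoc_of_third_deg_zero, Ext.mk₀_comp_mk₀,
    ← Ext.comp_assoc _ _ _ (zero_add 1) one_add_one_eq_two rfl, augExt_naturality,
    Ext.comp_assoc_of_second_deg_zero, ← Ext.comp_assoc_of_third_deg_zero (Ext.mk₀ _),
    signExt_naturality, Ext.comp_assoc_of_third_deg_zero, Ext.mk₀_comp_mk₀]

end PullbackClasses

/-! ### Sections of equivariant sheaves over open sets -/

section Sections

variable {X : Type} [TopologicalSpace X] [MulAction ℤˣ X] [ContinuousConstSMul ℤˣ X]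

/-- The sections of an equivariant sheaf over an open set. -/
abbrev sec (F : EqSheaf ℤˣ X) (U : Opens X) : Type := F.obj.obj (op ⟨U⟩)

/-- The inclusion of open sets, as a morphism of the site. -/
def incl {U V : Opens X} (h : U ≤ V) : (⟨U⟩ : EqOpens ℤˣ X) ⟶ ⟨V⟩ :=
  EqOpens.homMk 1 fun x hx => by rw [one_smul]; exact h hx

/-- Restriction of sections. -/
def res (F : EqSheaf ℤˣ X) {U V : Opens X} (h : U ≤ V) : sec F V →+ sec F U :=
  (F.obj.map (incl h).op).hom

/-- The action of a morphism of sheaves on sections. -/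
def secMap {F F' : EqSheaf ℤˣ X} (g : F ⟶ F') (U : Opens X) : sec F U →+ sec F' U :=
  (g.hom.app (op ⟨U⟩)).hom

variable {F F' : EqSheaf ℤˣ X}

theorem res_res {U V W : Opens X} (h : U ≤ V) (h' : V ≤ W) (s : sec F W) :
    res F h (res F h' s) = res F (h.trans h') s := by
  have e : incl h ≫ incl h' = incl (h.trans h') := EqOpens.hom_ext (mul_one _)
  have e' := congrArg (fun k => F.obj.map k.op s) e
  simp only [op_comp, F.obj.map_comp, ConcreteCategory.comp_apply] at e'
  exact e'

theorem res_self {U : Opens X} (s : sec F U) : res F le_rfl s = s := by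
  have e : incl (le_refl U) = 𝟙 _ := EqOpens.hom_ext rfl
  have e' := congrArg (fun k => F.obj.map k.op s) e
  simp only [op_id, F.obj.map_id, ConcreteCategory.id_apply] at e'
  exact e'

theorem secMap_res (g : F ⟶ F') {U V : Opens X} (h : U ≤ V) (s : sec F V) :
    secMap g U (res F h s) = res F' h (secMap g V s) :=
  congrArg (fun k => k.hom s) (g.hom.naturality (incl h).op)

theorem existsUnique_glue {ι : Type} {V : Opens X} (U : ι → Opens X) (hU : ∀ i, U i ≤ V)
    (hV : ∀ x ∈ V, ∃ i, x ∈ U i) (s : ∀ i, sec F (U i))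
    (hs : ∀ i j, res F inf_le_left (s i) = res F (inf_le_right : U i ⊓ U j ≤ U j) (s j)) :
    ∃! t : sec F V, ∀ i, res F (hU i) t = s i := by
  have hF : Presieve.IsSheaf (eqTopology ℤˣ X) (F.obj ⋙ forget AddCommGrpCat.{0}) := by
    rw [← isSheaf_iff_isSheaf_of_type, ← Presheaf.isSheaf_iff_isSheaf_forget]
    exact F.property
  have hc : Sieve.generate (Presieve.ofArrows (fun i => (⟨U i⟩ : EqOpens ℤˣ X))
      fun i => incl (hU i)) ∈ eqTopology ℤˣ X ⟨V⟩ := by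
    intro x hx
    obtain ⟨i, hi⟩ := hV x hx
    exact ⟨⟨U i⟩, incl (hU i), Sieve.le_generate _ _ _ (Presieve.ofArrows.mk i), x, hi, one_smul _ x⟩
  have := hF _ hc
  rw [← Presieve.isSheafFor_iff_generate, Presieve.isSheafFor_arrows_iff] at this
  refine this s fun i j Z a b hab => ?_
  have hg : EqOpens.elt a = EqOpens.elt b := by
    have := congrArg EqOpens.elt hab
    simpa [incl] using this
  let c : Z ⟶ ⟨U i ⊓ U j⟩ := EqOpens.homMk (EqOpens.elt a) fun x hx =>
    ⟨EqOpens.elt_mem a hx, by rw [hg]; exact EqOpens.elt_mem b hx⟩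
  have ha : c ≫ incl inf_le_left = a := EqOpens.hom_ext (one_mul _)
  have hb : c ≫ incl inf_le_right = b := EqOpens.hom_ext ((one_mul _).trans hg)
  have h := congrArg (F.obj.map c.op) (hs i j)
  have ea := congrArg (fun k => F.obj.map k.op (s i)) ha
  have eb := congrArg (fun k => F.obj.map k.op (s j)) hb
  simp only [op_comp, F.obj.map_comp, ConcreteCategory.comp_apply] at ea eb
  exact ea.symm.trans (h.trans eb)

theorem sec_ext {ι : Type} {V : Opens X} (U : ι → Opens X) (hU : ∀ i, U i ≤ V)
    (hV : ∀ x ∈ V, ∃ i, x ∈ U i) {t t' : sec F V}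
    (h : ∀ i, res F (hU i) t = res F (hU i) t') : t = t' :=
  (existsUnique_glue U hU hV (fun i => res F (hU i) t') (fun i j => by
    rw [res_res, res_res])).unique h fun _ => rfl

theorem sec_bot_ext {V : Opens X} (hV : V ≤ ⊥) (t t' : sec F V) : t = t' :=
  sec_ext (ι := Empty) (fun i => i.elim) (fun i => i.elim) (fun _ hx => (hV hx).elim)
    fun i => i.elim

theorem exists_glue_two {A B : Opens X} (s : sec F A) (t : sec F B)
    (h : res F inf_le_left s = res F (inf_le_right : A ⊓ B ≤ B) t) :
    ∃ r : sec F (A ⊔ B), res F le_sup_left r = s ∧ res F le_sup_right r = t := by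
  obtain ⟨r, hr, -⟩ := existsUnique_glue (F := F) (V := A ⊔ B) (fun b : Bool => cond b A B)
    (fun b => by cases b; exacts [le_sup_right, le_sup_left])
    (fun x hx => by
      rcases hx with hx | hx
      exacts [⟨true, hx⟩, ⟨false, hx⟩])
    (fun b => match b with
      | true => s
      | false => t)
    (fun b c => by
      cases b <;> cases c
      · rfl
      · have := congrArg (res F (inf_comm B A).le) h
        rw [res_res, res_res] at this
        exact this.symm
      · exact h
      · rfl)
  exact ⟨r, hr true, hr false⟩

theorem sec_ext_two {A B : Opens X} {r r' : sec F (A ⊔ B)}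
    (hA : res F le_sup_left r = res F le_sup_left r')
    (hB : res F le_sup_right r = res F le_sup_right r') : r = r' :=
  sec_ext (fun b : Bool => cond b A B)
    (fun b => by cases b; exacts [le_sup_right, le_sup_left])
    (fun x hx => by
      rcases hx with hx | hx
      exacts [⟨true, hx⟩, ⟨false, hx⟩])
    (fun b => by cases b; exacts [hB, hA])

/-- An epimorphism of equivariant sheaves is locally surjective on sections. -/
theorem exists_local_lift (g : F ⟶ F') [Epi g] {U : Opens X} (q : sec F' U) {x : X} (hx : x ∈ U) :
    ∃ (N : Opens X) (hN : N ≤ U) (i : sec F N), x ∈ N ∧ secMap g N i = res F' hN q := by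
  have hg : Presheaf.IsLocallySurjective (eqTopology ℤˣ X) g.hom :=
    (Sheaf.isLocallySurjective_iff_epi' AddCommGrpCat.{0} g).2 inferInstance
  obtain ⟨W, f, ⟨i, hi⟩, y, hy, hyx⟩ :=
    Presheaf.imageSieve_mem (eqTopology ℤˣ X) g.hom (U := op ⟨U⟩) q x hx
  let N : Opens X := U ⊓ (EqOpens.translate (EqOpens.elt f)⁻¹ W).carrier
  let k : (⟨N⟩ : EqOpens ℤˣ X) ⟶ W := EqOpens.homMk (EqOpens.elt f)⁻¹ fun z hz => hz.2
  have hk : k ≫ f = incl (inf_le_left : N ≤ U) := EqOpens.hom_ext (mul_inv_cancel _)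
  refine ⟨N, inf_le_left, F.obj.map k.op i, ⟨hx, ?_⟩, ?_⟩
  · change (EqOpens.elt f)⁻¹ • x ∈ W.carrier
    rw [← hyx, inv_smul_smul]
    exact hy
  · have e := congrArg (fun m => F'.obj.map m.op q) hk
    simp only [op_comp, F'.obj.map_comp, ConcreteCategory.comp_apply] at e
    refine Eq.trans ?_ e
    exact (congrArg (fun m => m.hom i) (g.hom.naturality k.op)).trans
      (congrArg (F'.obj.map k.op) hi)

/-- Left exactness of the functor of sections. -/
theorem exists_secMap_eq_of_exact {S : ShortComplex (EqSheaf ℤˣ X)} (hS : S.ShortExact)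
    {U : Opens X} (s : sec S.X₂ U) (h : secMap S.g U s = 0) :
    ∃ t : sec S.X₁ U, secMap S.f U t = s := by
  have := hS.mono_f
  let E := sheafToPresheaf (eqTopology ℤˣ X) AddCommGrpCat.{0} ⋙
    (evaluation (EqOpens ℤˣ X)ᵒᵖ AddCommGrpCat.{0}).obj (op ⟨U⟩)
  have hE : (S.map E).Exact :=
    (((Functor.preservesFiniteLimits_tfae E).out 1 3 rfl rfl).mpr inferInstance S
      ⟨hS.exact, hS.mono_f⟩).1
  exact (ShortComplex.ab_exact_iff _).1 hE s h

end Sections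

/-- The sections of an injective abelian sheaf extend along monomorphisms of the site. -/
theorem map_surjective_of_injective {C : Type} [SmallCategory C] {J : GrothendieckTopology C}
    (I : Sheaf J AddCommGrpCat.{0}) [Injective I] {W V : C} (u : W ⟶ V) [Mono u] :
    Function.Surjective (I.obj.map u.op) := by
  intro s
  let e (Z : C) : ((presheafToSheaf J AddCommGrpCat.{0}).obj
      (((Functor.whiskeringRight _ _ _).obj AddCommGrpCat.free).obj (yoneda.obj Z)) ⟶ I) ≃
        I.obj.obj (op Z) :=
    ((sheafificationAdjunction J AddCommGrpCat.{0}).homEquiv _ _).trans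
      (((AddCommGrpCat.adj.whiskerRight Cᵒᵖ).homEquiv _ _).trans yonedaEquiv)
  let m := (presheafToSheaf J AddCommGrpCat.{0}).map
    (((Functor.whiskeringRight Cᵒᵖ _ _).obj AddCommGrpCat.free).map (yoneda.map u))
  have (Z : Cᵒᵖ) : Mono ((((Functor.whiskeringRight Cᵒᵖ _ _).obj AddCommGrpCat.free).map
      (yoneda.map u)).app Z) := by
    change Mono (AddCommGrpCat.free.map ((yoneda.map u).app Z))
    infer_instance
  have : Mono (((Functor.whiskeringRight Cᵒᵖ _ _).obj AddCommGrpCat.free).map (yoneda.map u)) :=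
    NatTrans.mono_of_mono_app _
  have : Mono m := inferInstance
  refine ⟨e V (Injective.factorThru ((e W).symm s) m), ?_⟩
  have nat (ψ) : e W (m ≫ ψ) = I.obj.map u.op (e V ψ) := by
    simp only [e, m, Equiv.trans_apply, Adjunction.homEquiv_naturality_left]
    exact (yonedaEquiv_naturality _ u).symm
  rw [← nat, Injective.comp_factorThru, Equiv.apply_symm_apply]

theorem res_surjective_of_injective {X : Type} [TopologicalSpace X] [MulAction ℤˣ X]
    [ContinuousConstSMul ℤˣ X] (I : EqSheaf ℤˣ X) [Injective I] {U V : Opens X} (h : U ≤ V) :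
    Function.Surjective (res I h) := by
  have : Mono (incl (X := X) h) := ⟨fun a b hab => EqOpens.hom_ext (by
    simpa [incl] using congrArg EqOpens.elt hab)⟩
  exact map_surjective_of_injective I (incl h)

/-! ### Vanishing of cohomology on spaces with a finite-to-one map to the line -/

/-- On a compact space, an open neighbourhood of a level set contains a slab around it. -/
theorem exists_slab {X : Type} [TopologicalSpace X] [CompactSpace X] {h : X → ℝ}
    (hc : Continuous h) (m : ℝ) (N : Opens X)
    (hN : ∀ z, h z = m → z ∈ N) : ∃ δ > 0, ∀ z, |h z - m| < δ → z ∈ N := by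
  have hK : IsCompact (N : Set X)ᶜ := N.isOpen.isClosed_compl.isCompact
  obtain hE | hE := ((N : Set X)ᶜ).eq_empty_or_nonempty
  · exact ⟨1, one_pos, fun z _ => by_contra fun hz => (Set.eq_empty_iff_forall_notMem.1 hE z) hz⟩
  · obtain ⟨z₀, hz₀, hmin⟩ := hK.exists_isMinOn hE
      (f := fun z => |h z - m|) (by fun_prop)
    refine ⟨|h z₀ - m|, abs_pos.2 (sub_ne_zero.2 fun e => hz₀ (hN _ e)), fun z hz => ?_⟩
    by_contra hzN
    exact absurd (hmin hzN) (not_le.2 hz)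

section Sweep

variable {X : Type} [TopologicalSpace X] [MulAction ℤˣ X] [ContinuousConstSMul ℤˣ X]

/-- Every section near a pair of points agrees, near these points, with a global section. -/
def PairsExtend (F : EqSheaf ℤˣ X) : Prop :=
  ∀ (W : Opens X) (s : sec F W) (x y : X), x ∈ W → y ∈ W →
    ∃ (N : Opens X) (hN : N ≤ W) (t : sec F ⊤), x ∈ N ∧ y ∈ N ∧ res F le_top t = res F hN s

/-- Local lifts along an epimorphism exist near each pair of points. -/
theorem exists_lift_near_pair [T2Space X] {F F' : EqSheaf ℤˣ X} (g : F ⟶ F') [Epi g] {W : Opens X}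
    (q : sec F' W) {x y : X} (hx : x ∈ W) (hy : y ∈ W) :
    ∃ (N : Opens X) (hN : N ≤ W) (i : sec F N), x ∈ N ∧ y ∈ N ∧ secMap g N i = res F' hN q := by
  obtain ⟨A, hA, i, hxA, hi⟩ := exists_local_lift g q hx
  obtain rfl | hxy := eq_or_ne x y
  · exact ⟨A, hA, i, hxA, hxA, hi⟩
  obtain ⟨B, hB, j, hyB, hj⟩ := exists_local_lift g q hy
  obtain ⟨u, v, hu, hv, hxu, hyv, huv⟩ := t2_separation hxy
  let A' : Opens X := A ⊓ ⟨u, hu⟩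
  let B' : Opens X := B ⊓ ⟨v, hv⟩
  have hA' : A' ≤ A := inf_le_left
  have hB' : B' ≤ B := inf_le_left
  have hd : A' ⊓ B' ≤ ⊥ := fun z hz => (Set.disjoint_left.1 huv hz.1.2 hz.2.2).elim
  obtain ⟨r, hr₁, hr₂⟩ := exists_glue_two (res F hA' i) (res F hB' j) (sec_bot_ext hd _ _)
  refine ⟨A' ⊔ B', sup_le (hA'.trans hA) (hB'.trans hB), r, Or.inl ⟨hxA, hxu⟩, Or.inr ⟨hyB, hyv⟩,
    sec_ext_two ?_ ?_⟩
  · rw [← secMap_res, hr₁, secMap_res, hi, res_res, res_res]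
  · rw [← secMap_res, hr₂, secMap_res, hj, res_res, res_res]

/-- A quotient of an injective sheaf has the extension property for pairs. -/
theorem pairsExtend_of_epi [T2Space X] {I Q : EqSheaf ℤˣ X} [Injective I] (g : I ⟶ Q) [Epi g] :
    PairsExtend Q := by
  intro W s x y hx hy
  obtain ⟨N, hN, i, hxN, hyN, hi⟩ := exists_lift_near_pair g s hx hy
  obtain ⟨t, rfl⟩ := res_surjective_of_injective I (le_top : N ≤ ⊤) i
  exact ⟨N, hN, secMap g ⊤ t, hxN, hyN, by rw [← secMap_res, hi]⟩

/-- The section `q` of the quotient lifts over `U`. -/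
def LiftsOver {F F' : EqSheaf ℤˣ X} (g : F ⟶ F') (q : sec F' ⊤) (U : Opens X) : Prop :=
  ∃ i : sec F U, secMap g U i = res F' le_top q

theorem LiftsOver.mono {F F' : EqSheaf ℤˣ X} {g : F ⟶ F'} {q : sec F' ⊤} {U V : Opens X}
    (h : LiftsOver g q V) (hU : U ≤ V) : LiftsOver g q U := by
  obtain ⟨i, hi⟩ := h
  exact ⟨res F hU i, by rw [secMap_res, hi, res_res]⟩

/-- Two lifts whose difference extends globally from `N` merge, once their domains are shrunk so as
to overlap inside `N` only. -/
theorem LiftsOver.sup {S : ShortComplex (EqSheaf ℤˣ X)} {q : sec S.X₃ ⊤}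
    {A B N : Opens X} (i : sec S.X₂ A) (j : sec S.X₂ B)
    (hi : secMap S.g A i = res S.X₃ le_top q) (hj : secMap S.g B j = res S.X₃ le_top q)
    (hN : N ≤ A ⊓ B) (t : sec S.X₁ ⊤)
    (ht : res S.X₂ (hN.trans inf_le_left) i - res S.X₂ (hN.trans inf_le_right) j =
      secMap S.f N (res S.X₁ le_top t))
    {A' B' : Opens X} (hA : A' ≤ A) (hB : B' ≤ B) (hAB : A' ⊓ B' ≤ N) :
    LiftsOver S.g q (A' ⊔ B') := by
  have hz (U : Opens X) (z : sec S.X₁ U) : secMap S.g U (secMap S.f U z) = 0 :=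
    congrArg (fun k => k.hom.app (op ⟨U⟩) z) S.zero
  obtain ⟨r, hr₁, hr₂⟩ := exists_glue_two (res S.X₂ hA i)
    (res S.X₂ hB j + res S.X₂ le_top (secMap S.f ⊤ t)) (by
      have h := congrArg (res S.X₂ hAB) ht
      rw [map_sub, res_res, res_res, ← secMap_res, res_res, secMap_res, sub_eq_iff_eq_add] at h
      rw [map_add, res_res, res_res, res_res, h, add_comm])
  refine ⟨r, sec_ext_two ?_ ?_⟩
  · rw [← secMap_res, hr₁, secMap_res, hi, res_res, res_res]
  · rw [← secMap_res, hr₂, map_add, ← secMap_res, hz, add_zero, secMap_res, hj, res_res, res_res]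

variable [T2Space X] [CompactSpace X]

/-- If `X` maps to the line with fibres of at most two points, then sections lift along an
epimorphism whose kernel has the extension property for pairs. The lift is built over the sublevel
sets of `h`, which only have to be merged with thin slabs around level sets. -/
theorem secMap_top_surjective {S : ShortComplex (EqSheaf ℤˣ X)} (hS : S.ShortExact)
    (hF : PairsExtend S.X₁) {h : X → ℝ} (hc : Continuous h)
    (hfib : ∀ x, ∃ y, h y = h x ∧ ∀ z, h z = h x → z = x ∨ z = y) :
    Function.Surjective (secMap S.g ⊤) := by
  have := hS.epi_g
  intro q
  let L (r : ℝ) : Opens X := ⟨{z | h z < r}, isOpen_Iio.preimage hc⟩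
  let R (r : ℝ) : Opens X := ⟨{z | r < h z}, isOpen_Ioi.preimage hc⟩
  have slab (m : ℝ) : ∃ δ > 0, LiftsOver S.g q (R (m - δ) ⊓ L (m + δ)) := by
    have key : ∃ N : Opens X, (∀ z, h z = m → z ∈ N) ∧ LiftsOver S.g q N := by
      by_cases hm : ∃ x, h x = m
      · obtain ⟨x, rfl⟩ := hm
        obtain ⟨y, -, hy⟩ := hfib x
        obtain ⟨N, hN, i, hxN, hyN, hi⟩ := exists_lift_near_pair S.g q (x := x) (y := y)
          trivial trivial
        refine ⟨N, fun z hz => ?_, i, hi⟩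
        rcases hy z hz with rfl | rfl <;> assumption
      · exact ⟨⊥, fun z hz => (hm ⟨z, hz⟩).elim, 0, sec_bot_ext le_rfl _ _⟩
    obtain ⟨N, hN, hl⟩ := key
    obtain ⟨δ, hδ, hδN⟩ := exists_slab hc m N hN
    refine ⟨δ, hδ, hl.mono fun z hz => hδN z ?_⟩
    have h1 : m - δ < h z := hz.1
    have h2 : h z < m + δ := hz.2
    rw [abs_lt]
    constructor <;> linarith
  obtain ⟨b, hb⟩ : ∃ b, ∀ z, h z < b := by
    obtain ⟨b, hb⟩ := (isCompact_range hc).bddAbove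
    exact ⟨b + 1, fun z => (hb ⟨z, rfl⟩).trans_lt (lt_add_one b)⟩
  obtain ⟨a, ha⟩ : ∃ a, ∀ z, a < h z := by
    obtain ⟨a, ha⟩ := (isCompact_range hc).bddBelow
    exact ⟨a - 1, fun z => (sub_one_lt a).trans_le (ha ⟨z, rfl⟩)⟩
  -- it suffices to lift over arbitrarily high sublevel sets
  suffices hT : ∃ r, b ≤ r ∧ LiftsOver S.g q (L r) by
    obtain ⟨r, hr, hl⟩ := hT
    obtain ⟨i, hi⟩ := hl.mono (U := ⊤) fun z _ => (hb z).trans_le hr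
    exact ⟨i, hi.trans (res_self q)⟩
  by_contra hcon
  push Not at hcon
  let T : Set ℝ := {r | LiftsOver S.g q (L r)}
  have hTa : a ∈ T := ⟨0, sec_bot_ext (fun z hz => (lt_asymm (ha z) hz).elim) _ _⟩
  have hTb : BddAbove T := ⟨b, fun r hr => not_lt.1 fun hbr => hcon r hbr.le hr⟩
  set r₀ := sSup T
  obtain ⟨δ, hδ, j, hj⟩ := slab r₀
  obtain ⟨r, hrT, hr⟩ := exists_lt_of_lt_csSup ⟨a, hTa⟩ (sub_lt_self r₀ hδ)
  have hrr : r ≤ r₀ := le_csSup hTb hrT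
  obtain ⟨i, hi⟩ := id hrT
  -- the level at which the two lifts are merged
  obtain ⟨m, hm₁, hm₂⟩ := exists_between hr
  have hmA (z) (hz : h z = m) : z ∈ L r ⊓ (R (r₀ - δ) ⊓ L (r₀ + δ)) :=
    ⟨hz.trans_lt hm₂, hm₁.trans_eq hz.symm, show h z < r₀ + δ by linarith⟩
  obtain ⟨d, hd⟩ := exists_secMap_eq_of_exact hS (res S.X₂ inf_le_left i - res S.X₂
    (inf_le_right : L r ⊓ (R (r₀ - δ) ⊓ L (r₀ + δ)) ≤ _) j) (by
      rw [map_sub, secMap_res, secMap_res, hi, hj, res_res, res_res, sub_self])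
  have key : ∃ (N : Opens X) (hN : N ≤ L r ⊓ (R (r₀ - δ) ⊓ L (r₀ + δ))) (t : sec S.X₁ ⊤),
      (∀ z, h z = m → z ∈ N) ∧ res S.X₁ le_top t = res S.X₁ hN d := by
    by_cases hm : ∃ x, h x = m
    · obtain ⟨x, hx⟩ := hm
      obtain ⟨y, hyx, hy⟩ := hfib x
      obtain ⟨N, hN, t, hxN, hyN, ht⟩ := hF _ d x y (hmA x hx) (hmA y (hyx.trans hx))
      refine ⟨N, hN, t, fun z hz => ?_, ht⟩
      rcases hy z (hz.trans hx.symm) with rfl | rfl <;> assumption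
    · exact ⟨⊥, bot_le, 0, fun z hz => (hm ⟨z, hz⟩).elim, sec_bot_ext le_rfl _ _⟩
  obtain ⟨N, hN, t, hmN, ht⟩ := key
  obtain ⟨η, hη, hηN⟩ := exists_slab hc m N hmN
  have hlift : LiftsOver S.g q ((L r ⊓ L (m + η)) ⊔
      ((R (r₀ - δ) ⊓ L (r₀ + δ)) ⊓ R (m - η))) := by
    refine LiftsOver.sup i j hi hj hN t ?_ inf_le_left inf_le_left fun z hz => hηN z ?_
    · rw [ht, secMap_res, hd, map_sub, res_res, res_res]
    · have h1 : h z < m + η := hz.1.2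
      have h2 : m - η < h z := hz.2.2
      rw [abs_lt]
      constructor <;> linarith
  have hnew : r₀ + δ ∈ T := hlift.mono fun z hz => by
    have hz' : h z < r₀ + δ := hz
    by_cases h1 : h z < r ∧ h z < m + η
    · exact Or.inl h1
    · refine Or.inr ⟨⟨show r₀ - δ < h z from ?_, hz⟩, show m - η < h z from ?_⟩
      · by_contra h2
        exact h1 ⟨by linarith, by linarith⟩
      · by_contra h2
        exact h1 ⟨by linarith, by linarith⟩
  linarith [le_csSup hTb hnew]

end Sweep

section Vanishing

open Abelian

variable {X : Type} [TopologicalSpace X] [MulAction ℤˣ X] [ContinuousConstSMul ℤˣ X]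

/-- An embedding of `F` into an injective sheaf, completed to a short exact sequence. -/
def injSeq (F : EqSheaf ℤˣ X) : ShortComplex (EqSheaf ℤˣ X) :=
  ShortComplex.mk (Injective.ι F) (Limits.cokernel.π (Injective.ι F)) (Limits.cokernel.condition _)

instance (F : EqSheaf ℤˣ X) : Injective (injSeq F).X₂ :=
  inferInstanceAs (Injective (Injective.under F))

theorem injSeq_shortExact (F : EqSheaf ℤˣ X) : (injSeq F).ShortExact :=
  @ShortComplex.ShortExact.mk _ _ _ _ (ShortComplex.exact_cokernel (Injective.ι F))
    (inferInstanceAs (Mono (Injective.ι F)))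
    (inferInstanceAs (Epi (Limits.cokernel.π (Injective.ι F))))

/-- Morphisms out of the sheaf of the regular representation are global sections, so if global
sections lift along the quotient of an injective sheaf containing `F` by `F`, then the connecting
map onto `Ext¹` is zero. -/
theorem ext_reg_one_eq_zero {F : EqSheaf ℤˣ X} (h : Function.Surjective (secMap (injSeq F).g ⊤))
    (x : Ext (repSheaf X regRep) F 1) : x = 0 := by
  obtain ⟨y, hy⟩ := Ext.covariant_sequence_exact₁ (S := injSeq F) _ (injSeq_shortExact F) x
    (Ext.eq_zero_of_injective _) (zero_add 1)
  obtain ⟨k, rfl⟩ := (Ext.mk₀_bijective _ _).2 y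
  obtain ⟨i, hi⟩ := h (evTop k regGen)
  obtain ⟨k', hk'⟩ := exists_evTop_regGen (F := (injSeq F).X₂) i
  have e : k' ≫ (injSeq F).g = k := reg_hom_ext (by rw [evTop_comp, hk']; exact hi)
  rw [← hy, ← e, ← Ext.mk₀_comp_mk₀, Ext.comp_assoc_of_second_deg_zero,
    (injSeq_shortExact F).comp_extClass, Ext.comp_zero]
  rfl

/-- Dimension shifting along the injective embedding of `F`. -/
theorem ext_reg_two_eq_zero {F : EqSheaf ℤˣ X}
    (h : ∀ x : Ext (repSheaf X regRep) (injSeq F).X₃ 1, x = 0)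
    (x : Ext (repSheaf X regRep) F 2) : x = 0 := by
  obtain ⟨y, hy⟩ := Ext.covariant_sequence_exact₁ (S := injSeq F) _ (injSeq_shortExact F) x
    (Ext.eq_zero_of_injective _) one_add_one_eq_two
  rw [← hy, h y, Ext.zero_comp]
  rfl

theorem ext_reg_one_eq_zero_of_pairsExtend [T2Space X] [CompactSpace X] {h : X → ℝ}
    (hc : Continuous h) (hfib : ∀ x, ∃ y, h y = h x ∧ ∀ z, h z = h x → z = x ∨ z = y)
    {F : EqSheaf ℤˣ X} (hF : PairsExtend F) (x : Ext (repSheaf X regRep) F 1) : x = 0 :=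
  ext_reg_one_eq_zero (secMap_top_surjective (injSeq_shortExact F) hF hc hfib) x

theorem ext_reg_two_eq_zero_of_fibers [T2Space X] [CompactSpace X] {h : X → ℝ}
    (hc : Continuous h) (hfib : ∀ x, ∃ y, h y = h x ∧ ∀ z, h z = h x → z = x ∨ z = y)
    {F : EqSheaf ℤˣ X} (x : Ext (repSheaf X regRep) F 2) : x = 0 :=
  have := (injSeq_shortExact F).epi_g
  ext_reg_two_eq_zero (ext_reg_one_eq_zero_of_pairsExtend hc hfib
    (pairsExtend_of_epi (injSeq F).g)) x

/-- The whole space is the only neighbourhood of a point, so local lifts are global. -/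
theorem secMap_top_surjective_of_subsingleton [Subsingleton X] [Nonempty X] {F F' : EqSheaf ℤˣ X}
    (g : F ⟶ F') [Epi g] : Function.Surjective (secMap g ⊤) := by
  intro q
  obtain ⟨x⟩ := ‹Nonempty X›
  obtain ⟨N, hN, i, hxN, hi⟩ := exists_local_lift g q (x := x) trivial
  obtain rfl : N = ⊤ := top_unique fun y _ => Subsingleton.elim x y ▸ hxN
  exact ⟨i, hi.trans (res_self q)⟩

theorem ext_reg_one_eq_zero_of_subsingleton [Subsingleton X] [Nonempty X] {F : EqSheaf ℤˣ X}
    (x : Ext (repSheaf X regRep) F 1) : x = 0 :=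
  have := (injSeq_shortExact F).epi_g
  ext_reg_one_eq_zero (secMap_top_surjective_of_subsingleton _) x

theorem ext_reg_two_eq_zero_of_subsingleton [Subsingleton X] [Nonempty X] {F : EqSheaf ℤˣ X}
    (x : Ext (repSheaf X regRep) F 2) : x = 0 :=
  ext_reg_two_eq_zero ext_reg_one_eq_zero_of_subsingleton x

end Vanishing

/-! ### Smooth functions with values in the circle -/

theorem contMDiff_coe_circle : ContMDiff (𝓡 1) 𝓘(ℝ, ℂ) ∞ (fun u : Circle => (u : ℂ)) :=
  have := finrank_real_complex_fact'
  contMDiff_coe_sphere (E := ℂ) (n := 1)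

section Angle

/-- An angle of `u`, chosen by the branch of the argument that is smooth near `c`. -/
def angleNear (c u : Circle) : ℝ := Complex.arg c + Complex.arg ((u / c : Circle) : ℂ)

theorem exp_angleNear (c u : Circle) : Circle.exp (angleNear c u) = u := by
  rw [angleNear, Circle.exp_add, Circle.exp_arg, Circle.exp_arg, mul_div_cancel]

theorem contMDiffAt_angleNear {c u : Circle} (h : ((u / c : Circle) : ℂ) ∈ Complex.slitPlane) :
    ContMDiffAt (𝓡 1) 𝓘(ℝ, ℝ) ∞ (angleNear c) u := by
  have h₁ : ContMDiff (𝓡 1) 𝓘(ℝ, ℂ) ∞ (fun v : Circle => ((v / c : Circle) : ℂ)) := by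
    have h₂ : ContMDiff (𝓡 1) (𝓡 1) ∞ (fun v : Circle => v / c) := by
      simp only [div_eq_mul_inv]
      exact contMDiff_id.mul contMDiff_const
    exact contMDiff_coe_circle.comp h₂
  have h₃ : ContDiffAt ℝ ∞ Complex.log ((u / c : Circle) : ℂ) :=
    (Complex.contDiffAt_log h).restrict_scalars ℝ
  have h₄ : ContDiffAt ℝ ∞ (fun z : ℂ => Complex.arg c + (Complex.log z).im)
      ((u / c : Circle) : ℂ) :=
    contDiffAt_const.add (Complex.imCLM.contDiff.contDiffAt.comp _ h₃)
  have h₅ := h₄.contMDiffAt.comp u h₁.contMDiffAt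
  refine h₅.congr_of_eventuallyEq (Filter.Eventually.of_forall fun v => ?_)
  simp [angleNear, Complex.log_im]

theorem contMDiffAt_angleNear_self (c : Circle) :
    ContMDiffAt (𝓡 1) 𝓘(ℝ, ℝ) ∞ (angleNear c) c :=
  contMDiffAt_angleNear (by simp)

/-- A smooth circle-valued function near `x` agrees near `x` with one which is defined everywhere
and equal to `1` off a given neighbourhood of `x`. -/
theorem exists_circle_extension {E H M : Type} [NormedAddCommGroup E] [NormedSpace ℝ E]
    [FiniteDimensional ℝ E] [TopologicalSpace H] {I : ModelWithCorners ℝ E H}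
    [TopologicalSpace M] [ChartedSpace H M] [IsManifold I ∞ M] [T2Space M]
    {W : Opens M} (s : C^∞⟮I, W; 𝓡 1, Circle⟯) {x : M} (hx : x ∈ W) {V : Opens M} (hV : x ∈ V) :
    ∃ (N : Opens M) (_ : x ∈ N) (hN : N ≤ W ⊓ V) (t : M → Circle), ContMDiff I (𝓡 1) ∞ t ∧
      (∀ u (hu : u ∈ N), t u = s ⟨u, (hN hu).1⟩) ∧ ∀ u ∉ V, t u = 1 := by
  classical
  let c : Circle := s ⟨x, hx⟩
  let θ : M → ℝ := fun u => if h : u ∈ W then angleNear c (s ⟨u, h⟩) else 0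
  have hθ (u : W) : θ u.1 = angleNear c (s u) := dif_pos u.2
  -- the set where the angle relative to the value at `x` is smooth
  let A : Set W := {u | ((s u / c : Circle) : ℂ) ∈ Complex.slitPlane}
  have hA : IsOpen A := by
    refine Complex.isOpen_slitPlane.preimage ?_
    have : Continuous s := s.contMDiff.continuous
    fun_prop
  let N₀ : Opens M := ⟨Subtype.val '' A, W.isOpen.isOpenMap_subtype_val _ hA⟩
  have hxN₀ : x ∈ N₀ ⊓ V := ⟨⟨⟨x, hx⟩, by simp [A, c], rfl⟩, hV⟩
  obtain ⟨χ, -, hχ⟩ := (SmoothBumpFunction.nhds_basis_tsupport (I := I) x).mem_iff.1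
    ((N₀ ⊓ V).isOpen.mem_nhds hxN₀)
  have hsm : ContMDiff I 𝓘(ℝ, ℝ) ∞ (fun u => χ u * θ u) := by
    refine contMDiff_of_tsupport fun u hu => ?_
    have hu' : u ∈ N₀ := (hχ ((closure_mono fun v hv => left_ne_zero_of_mul hv) hu)).1
    obtain ⟨⟨u, huW⟩, huA, rfl⟩ := hu'
    refine ContMDiffAt.mul χ.contMDiffAt ?_
    refine (contMDiffAt_subtype_iff (U := W) (x := ⟨u, huW⟩)).1 ?_
    refine ((contMDiffAt_angleNear huA).comp _ (s.contMDiff _)).congr_of_eventuallyEq ?_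
    exact Filter.Eventually.of_forall hθ
  obtain ⟨N₁, hN₁, hN₁o, hxN₁⟩ := eventually_nhds_iff.1 χ.eventuallyEq_one
  let N : Opens M := ⟨N₁, hN₁o⟩ ⊓ (W ⊓ V)
  refine ⟨N, ⟨hxN₁, hx, hV⟩, inf_le_right, fun u => Circle.exp (χ u * θ u),
    contMDiff_circleExp.comp hsm, fun u hu => ?_, fun u hu => ?_⟩
  · change Circle.exp (χ u * θ u) = _
    rw [show χ u = 1 from hN₁ u hu.1, one_mul]
    exact (congrArg Circle.exp (hθ ⟨u, hu.2.1⟩)).trans (exp_angleNear _ _)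
  · have : χ u = 0 := by
      by_contra h
      exact hu (hχ (subset_closure h)).2
    change Circle.exp (χ u * θ u) = _
    rw [this, zero_mul, Circle.exp_zero]

end Angle

section USections

variable {E H M : Type} [NormedAddCommGroup E] [NormedSpace ℝ E] [TopologicalSpace H]
  {I : ModelWithCorners ℝ E H} [TopologicalSpace M] [ChartedSpace H M]
  [MulAction ℤˣ M] [SmoothConstSMul ℤˣ I M] [ContinuousConstSMul ℤˣ M] {ε : ZMod 2}

/-- A section of `𝒰^ε`, as a smooth function. -/
def uFun {U : Opens M} (s : sec (uSheaf I M ε) U) : C^∞⟮I, U; 𝓡 1, Circle⟯ :=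
  Additive.toMul (α := USections I M ⟨U⟩) s

/-- A smooth function, as a section of `𝒰^ε`. -/
def ofUFun {U : Opens M} (f : C^∞⟮I, U; 𝓡 1, Circle⟯) : sec (uSheaf I M ε) U :=
  Additive.ofMul (α := USections I M ⟨U⟩) f

theorem uFun_res {U V : Opens M} (h : U ≤ V) (s : sec (uSheaf I M ε) V) (x : U) :
    uFun (res _ h s) x = uFun s ⟨x, h x.2⟩ := by
  change circleAct ε (1 : ℤˣ)⁻¹ (uFun s ⟨(1 : ℤˣ) • x.1, _⟩) = _
  rw [inv_one, circleAct_one]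
  congr 2
  exact one_smul _ _

theorem uFun_ext {U : Opens M} {s t : sec (uSheaf I M ε) U} (h : ∀ x, uFun s x = uFun t x) :
    s = t :=
  ContMDiffMap.ext (f := uFun s) (g := uFun t) h

theorem uSheaf_pairsExtend [FiniteDimensional ℝ E] [IsManifold I ∞ M] [T2Space M] :
    PairsExtend (uSheaf I M ε) := by
  have glob (t : M → Circle) (ht : ContMDiff I (𝓡 1) ∞ t) :
      ∃ T : sec (uSheaf I M ε) ⊤, ∀ u, uFun T u = t u :=
    ⟨ofUFun ⟨fun u => t u.1, ht.comp contMDiff_subtype_val⟩, fun _ => rfl⟩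
  intro W s x y hx hy
  obtain rfl | hxy := eq_or_ne x y
  · obtain ⟨N, hxN, hN, t, ht, hts, -⟩ := exists_circle_extension (uFun s) hx (V := ⊤) trivial
    obtain ⟨T, hT⟩ := glob t ht
    refine ⟨N, hN.trans inf_le_left, T, hxN, hxN, uFun_ext fun u => ?_⟩
    exact (uFun_res _ _ _).trans ((hT _).trans ((hts _ u.2).trans
      (uFun_res (hN.trans inf_le_left) s u).symm))
  · obtain ⟨A, B, hA, hB, hxA, hyB, hAB⟩ := t2_separation hxy
    obtain ⟨N, hxN, hN, t, ht, hts, ht₁⟩ := exists_circle_extension (uFun s) hx (V := ⟨A, hA⟩) hxA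
    obtain ⟨N', hyN', hN', t', ht', hts', ht'₁⟩ :=
      exists_circle_extension (uFun s) hy (V := ⟨B, hB⟩) hyB
    obtain ⟨T, hT⟩ := glob (fun u => t u * t' u) (ht.mul ht')
    refine ⟨N ⊔ N', sup_le (hN.trans inf_le_left) (hN'.trans inf_le_left), T, Or.inl hxN,
      Or.inr hyN', uFun_ext fun u => ?_⟩
    refine (uFun_res _ _ _).trans ((hT _).trans (Eq.trans ?_ (uFun_res _ s u).symm))
    obtain ⟨u, hu | hu⟩ := u
    · change t u * t' u = _
      rw [ht'₁ u (Set.disjoint_left.1 hAB (hN hu).2), mul_one]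
      exact hts u hu
    · change t u * t' u = _
      rw [ht₁ u (Set.disjoint_right.1 hAB (hN' hu).2), one_mul]
      exact hts' u hu

end USections

section Lift

/-- A differentiable angle of a constant function is constant. -/
theorem eq_of_exp_eq_one {k : ℝ → ℝ} (hk : Differentiable ℝ k) (h : ∀ t, Circle.exp (k t) = 1)
    (s t : ℝ) : k s = k t := by
  refine is_const_of_deriv_eq_zero hk (fun r => ?_) s t
  have h₁ : HasDerivAt (fun t => Complex.exp (k t * Complex.I))
      (Complex.exp (k r * Complex.I) * (deriv k r * Complex.I)) r :=
    (((hk r).hasDerivAt.ofReal_comp).mul_const Complex.I).cexp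
  have h₂ : (fun t => Complex.exp (k t * Complex.I)) = fun _ => 1 := by
    funext t
    rw [← Circle.coe_exp, h t, Circle.coe_one]
  rw [h₂] at h₁
  have h₃ := h₁.unique (hasDerivAt_const r 1)
  simpa using h₃

/-- Smooth maps from the line to the circle have smooth angles: integrate `γ' / (iγ)`. -/
theorem exists_smooth_angle {γ : ℝ → Circle} (hγ : ContMDiff 𝓘(ℝ, ℝ) (𝓡 1) ∞ γ) (h₀ : γ 0 = 1) :
    ∃ h : ℝ → ℝ, ContDiff ℝ ∞ h ∧ h 0 = 0 ∧ ∀ t, Circle.exp (h t) = γ t := by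
  let c : ℝ → ℂ := fun t => γ t
  have hc : ContDiff ℝ ∞ c := (contMDiff_coe_circle.comp hγ).contDiff
  have hd (t : ℝ) : HasDerivAt c (deriv c t) t :=
    ((hc.differentiable (by simp)) t).hasDerivAt
  have hc1 (t : ℝ) : c t * starRingEnd ℂ (c t) = 1 := by
    rw [Complex.mul_conj, Circle.normSq_coe]; simp
  let w : ℝ → ℝ := fun t => (deriv c t * starRingEnd ℂ (c t)).im
  have hw : ContDiff ℝ ∞ w := by
    have h1 : ContDiff ℝ ∞ (deriv c) := (contDiff_infty_iff_deriv.1 hc).2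
    have h2 : ContDiff ℝ ∞ (fun t => starRingEnd ℂ (c t)) := Complex.conjCLE.contDiff.comp hc
    exact Complex.imCLM.contDiff.comp (h1.mul h2)
  -- the derivative of `γ` is orthogonal to `γ`
  have hperp (t : ℝ) : deriv c t = w t * Complex.I * c t := by
    have h1 : HasDerivAt (fun t => starRingEnd ℂ (c t)) (starRingEnd ℂ (deriv c t)) t :=
      Complex.conjCLE.toContinuousLinearMap.hasFDerivAt.comp_hasDerivAt t (hd t)
    have h2 := (hd t).mul h1
    have h3 : (c * fun t => starRingEnd ℂ (c t)) = fun _ => (1 : ℂ) := funext hc1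
    rw [h3] at h2
    have h4 := h2.unique (hasDerivAt_const t 1)
    have h5 : (deriv c t * starRingEnd ℂ (c t)).re = 0 := by
      have := congrArg Complex.re h4
      simp only [Complex.add_re, Complex.mul_re, Complex.conj_re, Complex.conj_im,
        Complex.zero_re] at this
      simp only [Complex.mul_re, Complex.conj_re, Complex.conj_im]
      linarith
    have h6 : deriv c t * starRingEnd ℂ (c t) = w t * Complex.I := by
      apply Complex.ext <;> simp [w, h5]
    rw [← h6, mul_assoc, mul_comm _ (c t), hc1, mul_one]
  let h : ℝ → ℝ := fun t => ∫ s in (0 : ℝ)..t, w s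
  have hh (t : ℝ) : HasDerivAt h (w t) t :=
    intervalIntegral.integral_hasDerivAt_right (hw.continuous.intervalIntegrable _ _)
      (hw.continuous.stronglyMeasurableAtFilter _ _) hw.continuous.continuousAt
  refine ⟨h, ?_, intervalIntegral.integral_same, fun t => ?_⟩
  · rw [contDiff_infty_iff_deriv]
    exact ⟨fun t => (hh t).differentiableAt, by rw [funext fun t => (hh t).deriv]; exact hw⟩
  · have h1 (r : ℝ) : HasDerivAt (fun t => Complex.exp (-(h t * Complex.I)) * c t) 0 r := by
      have := ((((hh r).ofReal_comp).mul_const Complex.I).neg.cexp).mul (hd r)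
      convert! this using 1
      rw [hperp r]
      ring
    have h2 := is_const_of_deriv_eq_zero (fun r => (h1 r).differentiableAt)
      (fun r => (h1 r).deriv) t 0
    have h3 : h 0 = 0 := intervalIntegral.integral_same
    have h4 : c 0 = 1 := by simp [c, h₀]
    simp only [h3, h4, Complex.ofReal_zero, zero_mul, neg_zero, Complex.exp_zero, mul_one] at h2
    rw [Complex.exp_neg, inv_mul_eq_one₀ (Complex.exp_ne_zero _)] at h2
    apply Circle.coe_injective
    rw [Circle.coe_exp]
    exact h2

/-- A smooth function with `f(ū) = f(u)⁻¹` which is trivial at both fixed points is of the form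
`g(u) / g(ū)`: take for `g` a square root of `f`. -/
theorem exists_div_eq {f : Circle → Circle} (hf : ContMDiff (𝓡 1) (𝓡 1) ∞ f)
    (hinv : ∀ u, f u⁻¹ = (f u)⁻¹) (h₁ : f 1 = 1) (h₂ : f (-1) = 1) :
    ∃ g : Circle → Circle, ContMDiff (𝓡 1) (𝓡 1) ∞ g ∧ ∀ u, f u = g u / g u⁻¹ := by
  obtain ⟨h, hh, h0, hexp⟩ := exists_smooth_angle (γ := fun t => f (Circle.exp t))
    (hf.comp contMDiff_circleExp) (by simpa using h₁)
  have hdiff : Differentiable ℝ h := hh.differentiable (by simp)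
  have hodd (t : ℝ) : h (-t) = -h t := by
    have := eq_of_exp_eq_one (k := fun t => h t + h (-t)) (by fun_prop) (fun t => by
      rw [Circle.exp_add, hexp, hexp, Circle.exp_neg, hinv, mul_inv_cancel]) t 0
    simp only [neg_zero, h0, add_zero] at this
    linarith
  -- the total change of the angle is an even multiple of `2π`, because of the value at `-1`
  have hper (t : ℝ) : h (t + 2 * Real.pi) = h t + 2 * h Real.pi := by
    have := eq_of_exp_eq_one (k := fun t => h (t + 2 * Real.pi) - h t) (by fun_prop) (fun t => by
      rw [Circle.exp_sub, hexp, hexp, Circle.exp_add, Circle.exp_two_pi, mul_one, div_self'])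
      t (-Real.pi)
    rw [show -Real.pi + 2 * Real.pi = Real.pi by ring, hodd] at this
    linarith
  let G : ℝ → Circle := fun t => Circle.exp (h t / 2)
  have hGsm : ContMDiff 𝓘(ℝ, ℝ) (𝓡 1) ∞ G :=
    contMDiff_circleExp.comp (hh.div_const 2).contMDiff
  have hpi : Circle.exp Real.pi = -1 := Circle.ext (by simp [Circle.coe_exp, Complex.exp_pi_mul_I])
  have hG : Function.Periodic G (2 * Real.pi) := fun t => by
    change Circle.exp _ = Circle.exp _
    rw [hper, add_div, mul_div_cancel_left₀ _ two_ne_zero, Circle.exp_add, hexp, hpi, h₂,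
      mul_one]
  let g : Circle → Circle := fun u => G (Complex.arg u)
  have hg (t : ℝ) : g (Circle.exp t) = G t := by
    obtain ⟨n, hn⟩ := Circle.exp_eq_exp.1 (Circle.exp_arg (Circle.exp t))
    change G (Complex.arg (Circle.exp t)) = G t
    rw [hn]
    exact hG.int_mul n t
  refine ⟨g, fun c => ?_, fun u => ?_⟩
  · have e : g = fun u => G (angleNear c u) := by
      funext u
      rw [← hg, exp_angleNear]
    rw [e]
    exact (hGsm _).comp c (contMDiffAt_angleNear_self c)
  · obtain ⟨t, rfl⟩ : ∃ t, Circle.exp t = u := ⟨_, Circle.exp_arg u⟩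
    rw [← Circle.exp_neg, hg, hg, ← hexp]
    change _ = Circle.exp (h t / 2) / Circle.exp (h (-t) / 2)
    rw [← Circle.exp_sub, hodd]
    congr 1
    ring

end Lift

/-! ### Cohomology classes of anti-invariant functions -/

section GlobalSections

variable {E H M : Type} [NormedAddCommGroup E] [NormedSpace ℝ E] [TopologicalSpace H]
  {I : ModelWithCorners ℝ E H} [TopologicalSpace M] [ChartedSpace H M]
  [MulAction ℤˣ M] [SmoothConstSMul ℤˣ I M] [ContinuousConstSMul ℤˣ M] {ε : ZMod 2}

/-- The values of a global section of `𝒰^ε`. -/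
def uVal (s : sec (uSheaf I M ε) ⊤) (x : M) : Circle := uFun s ⟨x, trivial⟩

theorem uVal_ext {s t : sec (uSheaf I M ε) ⊤} (h : ∀ x, uVal s x = uVal t x) : s = t :=
  uFun_ext fun x => h x.1

theorem uVal_add (s t : sec (uSheaf I M ε) ⊤) (x : M) :
    uVal (s + t) x = uVal s x * uVal t x := rfl

theorem uVal_neg (s : sec (uSheaf I M ε) ⊤) (x : M) : uVal (-s) x = (uVal s x)⁻¹ := rfl

theorem contMDiff_uVal (s : sec (uSheaf I M ε) ⊤) : ContMDiff I (𝓡 1) ∞ (uVal s) := fun x =>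
  (contMDiffAt_subtype_iff (U := (⊤ : Opens M)) (x := ⟨x, trivial⟩)).1
    ((uFun s).contMDiff ⟨x, trivial⟩)

theorem exists_uVal_eq {f : M → Circle} (hf : ContMDiff I (𝓡 1) ∞ f) :
    ∃ s : sec (uSheaf I M ε) ⊤, ∀ x, uVal s x = f x :=
  ⟨ofUFun ⟨fun u => f u.1, hf.comp contMDiff_subtype_val⟩, fun _ => rfl⟩

theorem uVal_topAct (s : sec (uSheaf I M ε) ⊤) (x : M) :
    uVal (topAct (uSheaf I M ε).obj (-1) s) x = circleAct ε (-1) (uVal s ((-1 : ℤˣ) • x)) := rfl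

theorem circleAct_zero_neg_one (z : Circle) : circleAct 0 (-1) z = z := by
  simp [circleAct]

theorem circleAct_one_neg_one (z : Circle) : circleAct 1 (-1) z = z⁻¹ := by
  simp [circleAct]

/-- The functions with `f ∘ τ = f⁻¹`. These are the anti-invariant sections of `𝒰⁰`, and also the
invariant sections of `𝒰¹`. -/
def AntiInvariant (s : sec (uSheaf I M ε) ⊤) : Prop :=
  ∀ x, uVal s ((-1 : ℤˣ) • x) = (uVal s x)⁻¹

theorem antiInvariant_iff_zero (s : sec (uSheaf I M 0) ⊤) :
    AntiInvariant s ↔ topAct (uSheaf I M 0).obj (-1) s = -s := by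
  refine ⟨fun h => uVal_ext fun x => ?_, fun h x => ?_⟩
  · rw [uVal_topAct, circleAct_zero_neg_one, uVal_neg, h]
  · rw [← uVal_neg, ← h, uVal_topAct, circleAct_zero_neg_one]

theorem antiInvariant_iff_one (s : sec (uSheaf I M 1) ⊤) :
    AntiInvariant s ↔ topAct (uSheaf I M 1).obj (-1) s = s := by
  refine ⟨fun h => uVal_ext fun x => ?_, fun h x => ?_⟩
  · rw [uVal_topAct, circleAct_one_neg_one, h, inv_inv]
  · conv_rhs => rw [← h]
    rw [uVal_topAct, circleAct_one_neg_one, inv_inv]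

/-- A relation between functions and cohomology classes which identifies `Hⁿ(M; ℤ₂, 𝒰^ε)` with the
group of functions `f` such that `f ∘ τ = f⁻¹`, modulo those of the form `g / (g ∘ τ)`. -/
structure Presents {n : ℕ}
    (R : sec (uSheaf I M ε) ⊤ → EqCohomology (uSheaf I M ε) n → Prop) : Prop where
  exists_class {s} : AntiInvariant s → ∃ ξ, R s ξ
  exists_section (ξ) : ∃ s, R s ξ
  antiInvariant {s ξ} : R s ξ → AntiInvariant s
  add {s t ξ η} : R s ξ → R t η → R (s + t) (ξ + η)
  eq_zero_iff {s ξ} : R s ξ → (ξ = 0 ↔ ∃ g : sec (uSheaf I M ε) ⊤,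
    ∀ x, uVal s x = uVal g x / uVal g ((-1 : ℤˣ) • x))

/-- The class of an anti-invariant section of `𝒰⁰`. -/
def SignClassRel (s : sec (uSheaf I M 0) ⊤) (ξ : EqCohomology (uSheaf I M 0) 1) : Prop :=
  ∃ f : repSheaf M signRep ⟶ uSheaf I M 0, evTop f 1 = s ∧ signClass f = ξ

/-- The class of an invariant section of `𝒰¹`. -/
def TrivClassRel (s : sec (uSheaf I M 1) ⊤) (ξ : EqCohomology (uSheaf I M 1) 2) : Prop :=
  ∃ f : repSheaf M trivRep ⟶ uSheaf I M 1, evTop f ⟨1⟩ = s ∧ trivClass f = ξ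

open Abelian in
theorem presents_signClassRel (h : ∀ x : Ext (repSheaf M regRep) (uSheaf I M 0) 1, x = 0) :
    Presents (SignClassRel (I := I) (M := M)) where
  exists_class {s} hs := by
    obtain ⟨f, hf⟩ := exists_evTop_sign s ((antiInvariant_iff_zero s).1 hs)
    exact ⟨_, f, hf, rfl⟩
  exists_section ξ := by
    obtain ⟨f, hf⟩ := signClass_surjective h ξ
    exact ⟨_, f, rfl, hf⟩
  antiInvariant := by
    rintro _ _ ⟨f, rfl, -⟩
    refine (antiInvariant_iff_zero _).2 ((topAct_evTop f (-1) 1).trans ?_)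
    rw [← map_neg]
    rfl
  add := by
    rintro _ _ _ _ ⟨f, rfl, rfl⟩ ⟨f', rfl, rfl⟩
    exact ⟨f + f', evTop_add f f' 1, signClass_add f f'⟩
  eq_zero_iff := by
    rintro _ _ ⟨f, rfl, rfl⟩
    refine (signClass_eq_zero_iff f).trans (exists_congr fun g => ?_)
    refine ⟨fun e x => ?_, fun e => uVal_ext fun x => ?_⟩
    · rw [e, sub_eq_add_neg]
      refine (uVal_add _ _ x).trans ?_
      rw [uVal_neg, uVal_topAct, circleAct_zero_neg_one, div_eq_mul_inv]
    · rw [e, sub_eq_add_neg]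
      refine Eq.trans ?_ (uVal_add _ _ x).symm
      rw [uVal_neg, uVal_topAct, circleAct_zero_neg_one, div_eq_mul_inv]

open Abelian in
theorem presents_trivClassRel (h₁ : ∀ x : Ext (repSheaf M regRep) (uSheaf I M 1) 1, x = 0)
    (h₂ : ∀ x : Ext (repSheaf M regRep) (uSheaf I M 1) 2, x = 0) :
    Presents (TrivClassRel (I := I) (M := M)) where
  exists_class {s} hs := by
    obtain ⟨f, hf⟩ := exists_evTop_triv s ((antiInvariant_iff_one s).1 hs)
    exact ⟨_, f, hf, rfl⟩
  exists_section ξ := by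
    obtain ⟨f, hf⟩ := trivClass_surjective h₁ h₂ ξ
    exact ⟨_, f, rfl, hf⟩
  antiInvariant := by
    rintro _ _ ⟨f, rfl, -⟩
    exact (antiInvariant_iff_one _).2 (topAct_evTop f (-1) ⟨1⟩)
  add := by
    rintro _ _ _ _ ⟨f, rfl, rfl⟩ ⟨f', rfl, rfl⟩
    exact ⟨f + f', evTop_add f f' ⟨1⟩, trivClass_add f f'⟩
  eq_zero_iff := by
    rintro _ _ ⟨f, rfl, rfl⟩
    refine (trivClass_eq_zero_iff h₁ f).trans (exists_congr fun g => ?_)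
    refine ⟨fun e x => ?_, fun e => uVal_ext fun x => ?_⟩
    · rw [e]
      refine (uVal_add _ _ x).trans ?_
      rw [uVal_topAct, circleAct_one_neg_one, div_eq_mul_inv]
    · rw [e]
      refine Eq.trans ?_ (uVal_add _ _ x).symm
      rw [uVal_topAct, circleAct_one_neg_one, div_eq_mul_inv]

theorem Presents.eq_of_eq {n : ℕ} {R : sec (uSheaf I M ε) ⊤ → EqCohomology (uSheaf I M ε) n → Prop}
    (hR : Presents R) {s t ξ η} (h₁ : R s ξ) (h₂ : R t η) (h : ∀ x, uVal s x = uVal t x) :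
    ξ = η := by
  obtain rfl := uVal_ext h
  obtain ⟨ζ, hζ⟩ := hR.exists_class (s := -s) fun x => by
    rw [uVal_neg, uVal_neg, hR.antiInvariant h₁ x]
  have key {ξ} (h : R s ξ) : ξ + ζ = 0 := (hR.eq_zero_iff (hR.add h hζ)).2 ⟨0, fun x => by
    rw [add_neg_cancel]
    change (1 : Circle) = 1 / 1
    rw [div_one]⟩
  exact add_right_cancel ((key h₁).trans (key h₂).symm)

end GlobalSections

section Pullback

variable {E H M : Type} [NormedAddCommGroup E] [NormedSpace ℝ E] [TopologicalSpace H]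
  {I : ModelWithCorners ℝ E H} [TopologicalSpace M] [ChartedSpace H M]
  [MulAction ℤˣ M] [SmoothConstSMul ℤˣ I M] [ContinuousConstSMul ℤˣ M]
  {E' H' N : Type} [NormedAddCommGroup E'] [NormedSpace ℝ E'] [TopologicalSpace H']
  {I' : ModelWithCorners ℝ E' H'} [TopologicalSpace N] [ChartedSpace H' N]
  [MulAction ℤˣ N] [SmoothConstSMul ℤˣ I' N] [ContinuousConstSMul ℤˣ N]
  (φ : N →[ℤˣ] M) (hφ : ContMDiff I' I ∞ φ)

/-- Composition of a global section of `𝒰^ε` with `φ`. -/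
def uValComp {ε : ZMod 2} (s : sec (uSheaf I M ε) ⊤) : sec (uSheaf I' N ε) ⊤ :=
  (uComp I I' ε φ hφ).hom.app (op ⟨⊤⟩) s

theorem uVal_uValComp {ε : ZMod 2} (s : sec (uSheaf I M ε) ⊤) (x : N) :
    uVal (uValComp φ hφ s) x = uVal s (φ x) := rfl

theorem SignClassRel.pullback {s : sec (uSheaf I M 0) ⊤} {ξ} (h : SignClassRel s ξ) :
    SignClassRel (uValComp φ hφ s) (uPullback I I' 0 φ hφ 1 ξ) := by
  obtain ⟨f, rfl, rfl⟩ := h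
  have ha : AntiInvariant (evTop f 1) := (antiInvariant_iff_zero _).2
    ((topAct_evTop f (-1) 1).trans (by rw [← map_neg]; rfl))
  obtain ⟨f', hf'⟩ := exists_evTop_sign (uValComp φ hφ (evTop f 1))
    ((antiInvariant_iff_zero _).1 fun x => by
      rw [uVal_uValComp, uVal_uValComp, map_smul]
      exact ha (φ x))
  exact ⟨f', hf', (pullback_signClass (uComp I I' 0 φ hφ) f f' hf').symm⟩

theorem TrivClassRel.pullback {s : sec (uSheaf I M 1) ⊤} {ξ} (h : TrivClassRel s ξ) :
    TrivClassRel (uValComp φ hφ s) (uPullback I I' 1 φ hφ 2 ξ) := by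
  obtain ⟨f, rfl, rfl⟩ := h
  have ha : AntiInvariant (evTop f ⟨1⟩) := (antiInvariant_iff_one _).2 (topAct_evTop f (-1) ⟨1⟩)
  obtain ⟨f', hf'⟩ := exists_evTop_triv (uValComp φ hφ (evTop f ⟨1⟩))
    ((antiInvariant_iff_one _).1 fun x => by
      rw [uVal_uValComp, uVal_uValComp, map_smul]
      exact ha (φ x))
  exact ⟨f', hf', (pullback_trivClass (uComp I I' 1 φ hφ) f f' hf').symm⟩

end Pullback

/-! ### The point and the circle -/

section Signs

theorem circle_eq_one_or_neg_one {z : Circle} (h : z = z⁻¹) : z = 1 ∨ z = -1 := by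
  have h₁ : z * z = 1 := by
    nth_rewrite 1 [h]
    exact inv_mul_cancel z
  have h₂ : (z : ℂ) * z = 1 := by rw [← Circle.coe_mul, h₁, Circle.coe_one]
  rcases mul_self_eq_one_iff.1 h₂ with h₃ | h₃
  · exact Or.inl (Circle.ext h₃)
  · exact Or.inr (Circle.ext (by rw [h₃]; rfl))

theorem circle_neg_one_ne_one : (-1 : Circle) ≠ 1 := fun h => by
  have : (-1 : ℂ) = 1 := congrArg (fun z : Circle => (z : ℂ)) h
  norm_num at this

open Classical in
/-- The sign of an element of order two of the circle. -/
def circleSign (z : Circle) : ℤˣ := if z = 1 then 1 else -1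

theorem circleSign_one : circleSign 1 = 1 := if_pos rfl

theorem circleSign_neg_one : circleSign (-1) = -1 := if_neg circle_neg_one_ne_one

theorem circleSign_mul {z w : Circle} (hz : z = z⁻¹) (hw : w = w⁻¹) :
    circleSign (z * w) = circleSign z * circleSign w := by
  rcases circle_eq_one_or_neg_one hz with rfl | rfl <;>
    rcases circle_eq_one_or_neg_one hw with rfl | rfl <;>
    simp [circleSign_one, circleSign_neg_one]

theorem eq_of_circleSign_eq {z w : Circle} (hz : z = z⁻¹) (hw : w = w⁻¹)
    (h : circleSign z = circleSign w) : z = w := by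
  have h' : (-1 : ℤˣ) ≠ 1 := by decide
  rcases circle_eq_one_or_neg_one hz with rfl | rfl <;>
    rcases circle_eq_one_or_neg_one hw with rfl | rfl
  · rfl
  · rw [circleSign_one, circleSign_neg_one] at h
    exact absurd h.symm h'
  · rw [circleSign_one, circleSign_neg_one] at h
    exact absurd h h'
  · rfl

theorem neg_one_smul_circle (u : Circle) : (-1 : ℤˣ) • u = u⁻¹ := by
  rw [smul_circle_def]; simp

theorem eq_fixedOne_or_fixedNegOne (m : MulAction.fixedPoints ℤˣ Circle) :
    m = fixedOne ∨ m = fixedNegOne := by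
  have h : m.1 = m.1⁻¹ := by rw [← neg_one_smul_circle]; exact (m.2 (-1)).symm
  rcases circle_eq_one_or_neg_one h with h | h
  · exact Or.inl (Subtype.ext h)
  · exact Or.inr (Subtype.ext h)

theorem fixedNegOne_ne_fixedOne : fixedNegOne ≠ fixedOne := fun h =>
  circle_neg_one_ne_one (congrArg Subtype.val h)

instance : Finite (MulAction.fixedPoints ℤˣ Circle) :=
  Finite.of_surjective (fun b : Bool => cond b fixedOne fixedNegOne) fun m => by
    rcases eq_fixedOne_or_fixedNegOne m with rfl | rfl
    exacts [⟨true, rfl⟩, ⟨false, rfl⟩]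

/-- Sign choices on `S^{1,1}` are pairs of signs. -/
theorem exists_signChoices_equiv : ∃ ρ : SignChoices Circle ≃* ℤˣ × ℤˣ,
    ∀ f, ρ f = (f fixedOne, f fixedNegOne) := by
  classical
  let ρ : SignChoices Circle →* ℤˣ × ℤˣ :=
    { toFun := fun f => (f fixedOne, f fixedNegOne)
      map_one' := rfl
      map_mul' := fun _ _ => rfl }
  refine ⟨MulEquiv.ofBijective ρ ⟨fun f f' h => ?_, fun p => ?_⟩, fun f => rfl⟩
  · ext m
    rcases eq_fixedOne_or_fixedNegOne m with rfl | rfl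
    · exact congrArg (fun p : ℤˣ × ℤˣ => (p.1 : ℤ)) h
    · exact congrArg (fun p : ℤˣ × ℤˣ => (p.2 : ℤ)) h
  · refine ⟨⟨fun m => if m = fixedOne then p.1 else p.2, IsLocallyConstant.of_discrete _⟩, ?_⟩
    exact Prod.ext (if_pos rfl) (if_neg fixedNegOne_ne_fixedOne)

end Signs

section Main

variable {n : ℕ} {ε : ZMod 2}
  {P : sec (uSheaf 𝓘(ℝ, PUnit) PUnit ε) ⊤ → PointCohomology n ε → Prop}

theorem Presents.pointSign_eq (hP : Presents P) {s ξ} (h : P s ξ) :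
    pointSign ξ = circleSign (uVal s PUnit.unit) := by
  have h₀ : ξ = 0 ↔ uVal s PUnit.unit = 1 := by
    rw [hP.eq_zero_iff h]
    constructor
    · rintro ⟨g, hg⟩
      rw [hg]
      exact div_self' _
    · exact fun e => ⟨0, fun x => e.trans (div_self' _).symm⟩
  rw [pointSign, circleSign]
  by_cases hξ : ξ = 0
  · rw [if_pos hξ, if_pos (h₀.1 hξ)]
  · rw [if_neg hξ, if_neg fun e => hξ (h₀.2 e)]

theorem Presents.val_eq_inv (hP : Presents P) {s ξ} (h : P s ξ) :
    uVal s PUnit.unit = (uVal s PUnit.unit)⁻¹ := hP.antiInvariant h PUnit.unit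

theorem exists_point_section (z : Circle) :
    ∃ s : sec (uSheaf 𝓘(ℝ, PUnit) PUnit ε) ⊤, ∀ x, uVal s x = z :=
  exists_uVal_eq contMDiff_const

theorem Presents.card_point (hP : Presents P) : Nat.card (PointCohomology n ε) = 2 := by
  have hb : Function.Bijective (pointSign : PointCohomology n ε → ℤˣ) := by
    refine ⟨fun ξ η h => ?_, fun e => ?_⟩
    · obtain ⟨s, hs⟩ := hP.exists_section ξ
      obtain ⟨t, ht⟩ := hP.exists_section η
      rw [hP.pointSign_eq hs, hP.pointSign_eq ht] at h
      exact hP.eq_of_eq hs ht fun _ => eq_of_circleSign_eq (hP.val_eq_inv hs) (hP.val_eq_inv ht) h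
    · have key (z : Circle) (hz : z = z⁻¹) : ∃ ξ : PointCohomology n ε,
          pointSign ξ = circleSign z := by
        obtain ⟨s, hs⟩ := exists_point_section (ε := ε) z
        obtain ⟨ξ, hξ⟩ := hP.exists_class (s := s) fun x =>
          (hs _).trans (hz.trans (congrArg _ (hs x)).symm)
        exact ⟨ξ, by rw [hP.pointSign_eq hξ, hs]⟩
      rcases Int.units_eq_one_or e with rfl | rfl
      · rw [← circleSign_one]
        exact key 1 (by simp)
      · rw [← circleSign_neg_one]
        exact key (-1) (by simp)
  rw [Nat.card_eq_of_bijective _ hb]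
  simp

variable {C : sec (uSheaf (𝓡 1) Circle ε) ⊤ → CircleCohomology n ε → Prop}

/-- The sign choice map is an isomorphism as soon as cohomology classes on the circle and on the
point are compatibly presented by functions: the sign choice of the class of `f` is the value of
`f` at the fixed points. -/
theorem exists_signChoice_equiv (hC : Presents C) (hP : Presents P)
    (hpull : ∀ (m : MulAction.fixedPoints ℤˣ Circle) {s ξ}, C s ξ →
      P (uValComp (pointInclusion m) (contMDiff_pointInclusion (𝓡 1) m) s)
        (uPullback (𝓡 1) 𝓘(ℝ, PUnit) ε (pointInclusion m)
          (contMDiff_pointInclusion (𝓡 1) m) n ξ)) :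
    ∃ σ : CircleCohomology n ε ≃+ Additive (SignChoices Circle),
      ∀ ξ m, (σ ξ).toMul m = signChoice (𝓡 1) ξ m := by
  have hval {s ξ} (h : C s ξ) (m : MulAction.fixedPoints ℤˣ Circle) :
      signChoice (𝓡 1) ξ m = circleSign (uVal s m.1) :=
    hP.pointSign_eq (hpull m h)
  have hinv {s ξ} (h : C s ξ) (m : MulAction.fixedPoints ℤˣ Circle) :
      uVal s m.1 = (uVal s m.1)⁻¹ := hP.val_eq_inv (hpull m h)
  let σ : CircleCohomology n ε →+ Additive (SignChoices Circle) :=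
    AddMonoidHom.mk' (fun ξ => Additive.ofMul
      (⟨fun m => signChoice (𝓡 1) ξ m, IsLocallyConstant.of_discrete _⟩ : SignChoices Circle))
      fun ξ η => by
        obtain ⟨s, hs⟩ := hC.exists_section ξ
        obtain ⟨t, ht⟩ := hC.exists_section η
        refine congrArg Additive.ofMul (LocallyConstant.ext fun m => ?_)
        change signChoice (𝓡 1) (ξ + η) m = signChoice (𝓡 1) ξ m * signChoice (𝓡 1) η m
        rw [hval hs, hval ht, hval (hC.add hs ht), uVal_add,
          circleSign_mul (hinv hs m) (hinv ht m)]
  have hσ (ξ m) : (σ ξ).toMul m = signChoice (𝓡 1) ξ m := rfl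
  refine ⟨AddEquiv.ofBijective σ ⟨?_, fun f => ?_⟩, hσ⟩
  · rw [injective_iff_map_eq_zero]
    intro ξ hξ
    obtain ⟨s, hs⟩ := hC.exists_section ξ
    have h₁ (m : MulAction.fixedPoints ℤˣ Circle) : uVal s m.1 = 1 := by
      refine eq_of_circleSign_eq (hinv hs m) inv_one.symm ?_
      rw [← hval hs, ← hσ, hξ, circleSign_one]
      rfl
    obtain ⟨g, hg, hsg⟩ := exists_div_eq (contMDiff_uVal s) (fun u => by
      rw [← neg_one_smul_circle]
      exact hC.antiInvariant hs u) (h₁ fixedOne) (h₁ fixedNegOne)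
    obtain ⟨g', hg'⟩ := exists_uVal_eq (ε := ε) hg
    exact (hC.eq_zero_iff hs).2 ⟨g', fun u => by rw [hg', hg', neg_one_smul_circle, hsg]⟩
  · have key (h : Circle → Circle) (hh : ContMDiff (𝓡 1) (𝓡 1) ∞ h) (hi : ∀ u, h u⁻¹ = (h u)⁻¹)
        (h₁ : circleSign (h 1) = f.toMul fixedOne)
        (h₂ : circleSign (h (-1)) = f.toMul fixedNegOne) : ∃ ξ, σ ξ = f := by
      obtain ⟨s, hs⟩ := exists_uVal_eq (ε := ε) hh
      obtain ⟨ξ, hξ⟩ := hC.exists_class (s := s) fun u => by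
        rw [hs, hs, neg_one_smul_circle, hi]
      refine ⟨ξ, congrArg Additive.ofMul (LocallyConstant.ext fun m => ?_)⟩
      change signChoice (𝓡 1) ξ m = f.toMul m
      rw [hval hξ, hs]
      rcases eq_fixedOne_or_fixedNegOne m with rfl | rfl
      · exact h₁
      · exact h₂
    -- the four sign choices are those of `1`, `u`, `-u` and `-1`
    rcases Int.units_eq_one_or (f.toMul fixedOne) with e₁ | e₁ <;>
      rcases Int.units_eq_one_or (f.toMul fixedNegOne) with e₂ | e₂ <;>
      rw [e₁, e₂] at key
    · exact key (fun _ => 1) contMDiff_const (by simp) circleSign_one circleSign_one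
    · exact key id contMDiff_id (by simp) circleSign_one circleSign_neg_one
    · refine key (fun u => -1 * u) (contMDiff_const.mul contMDiff_id) (fun u => ?_) ?_ ?_
      · rw [mul_inv, inv_neg, inv_one]
      · rw [mul_one, circleSign_neg_one]
      · rw [neg_one_mul, neg_neg, circleSign_one]
    · exact key (fun _ => -1) contMDiff_const (by simp) circleSign_neg_one circleSign_neg_one

theorem circle_re_fibers (x : Circle) : ∃ y : Circle, (y : ℂ).re = (x : ℂ).re ∧
    ∀ z : Circle, (z : ℂ).re = (x : ℂ).re → z = x ∨ z = y := by
  refine ⟨x⁻¹, by simp, fun z hz => ?_⟩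
  have hx := Circle.normSq_coe x
  have hz' := Circle.normSq_coe z
  rw [Complex.normSq_apply] at hx hz'
  have : (z : ℂ).im * (z : ℂ).im = (x : ℂ).im * (x : ℂ).im := by
    rw [hz] at hz'; linarith
  rcases mul_self_eq_mul_self_iff.1 this with h | h
  · exact Or.inl (Circle.ext (Complex.ext hz h))
  · exact Or.inr (Circle.ext (Complex.ext (by simpa [Circle.coe_inv_eq_conj] using hz)
      (by simpa [Circle.coe_inv_eq_conj] using h)))

open Abelian in
theorem circle_ext_one_eq_zero
    (x : Ext (repSheaf Circle regRep) (uSheaf (𝓡 1) Circle ε) 1) : x = 0 :=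
  ext_reg_one_eq_zero_of_pairsExtend (h := fun u : Circle => (u : ℂ).re) (by fun_prop)
    circle_re_fibers uSheaf_pairsExtend x

open Abelian in
theorem circle_ext_two_eq_zero
    (x : Ext (repSheaf Circle regRep) (uSheaf (𝓡 1) Circle ε) 2) : x = 0 :=
  ext_reg_two_eq_zero_of_fibers (h := fun u : Circle => (u : ℂ).re) (by fun_prop)
    circle_re_fibers x

end Main

end SignChoice

end

theorem mainTheorem9 :
    -- the cohomology of a point, in which the sign choices take their values, is `ℤ₂`
    (Nat.card (SignChoice.PointCohomology 2 1) = 2 ∧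
      Nat.card (SignChoice.PointCohomology 1 0) = 2) ∧
    -- the identification `H⁰((S^{1,1})^τ, ℤ₂) = ℤ₂²`
    (∃ ρ : SignChoice.SignChoices Circle ≃* ℤˣ × ℤˣ,
      ∀ f, ρ f = (f SignChoice.fixedOne, f SignChoice.fixedNegOne)) ∧
    -- the sign choice map `σ₂` on `H²(S^{1,1}; ℤ₂, 𝒰¹)` is an isomorphism
    (∃ σ₂ : SignChoice.CircleCohomology 2 1 ≃+ Additive (SignChoice.SignChoices Circle),
      ∀ ξ m, (σ₂ ξ).toMul m = SignChoice.signChoice (𝓡 1) ξ m) ∧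
    -- the sign choice map `σ₁` on `H¹(S^{1,1}; ℤ₂, 𝒰⁰)` is an isomorphism
    (∃ σ₁ : SignChoice.CircleCohomology 1 0 ≃+ Additive (SignChoice.SignChoices Circle),
      ∀ ξ m, (σ₁ ξ).toMul m = SignChoice.signChoice (𝓡 1) ξ m) := by
  have h₁ := SignChoice.presents_signClassRel (I := 𝓘(ℝ, PUnit)) (M := PUnit)
    SignChoice.ext_reg_one_eq_zero_of_subsingleton
  have h₂ := SignChoice.presents_trivClassRel (I := 𝓘(ℝ, PUnit)) (M := PUnit)
    SignChoice.ext_reg_one_eq_zero_of_subsingleton SignChoice.ext_reg_two_eq_zero_of_subsingleton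
  exact ⟨⟨h₂.card_point, h₁.card_point⟩, SignChoice.exists_signChoices_equiv,
    SignChoice.exists_signChoice_equiv (SignChoice.presents_trivClassRel
      SignChoice.circle_ext_one_eq_zero SignChoice.circle_ext_two_eq_zero)
      h₂ fun m _ _ h => h.pullback _ _,
    SignChoice.exists_signChoice_equiv (SignChoice.presents_signClassRel
      SignChoice.circle_ext_one_eq_zero)
      h₁ fun m _ _ h => h.pullback _ _⟩
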